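/- **Theorem (Adequacy of Encoding).** Let $V$ be a set of variable names and $C$ a set of constant names. *Böhm trees.* A $\bot$-free Böhm tree (not necessarily productive) is a possibly infinite tree, taken up to renaming of bound variables, each of whose nodes has the form $\lambda x_1.\dots\lambda x_l.\ h\cdot(M_1;\dots;M_m)$ with finite $l,m\ge 0$, where the head $h$ is a bound or free variable or a constant from $C$ and the $M_i$ are again $\bot$-free Böhm trees. Formally it is a coherent sequence of its observations at the finite depths, for the grammar $BT_{(k+1)} ::= \lambda x.\,BT_{(k+1)} \mid h\cdot(BT_{(k)};\dots;BT_{(k)})$ with unobservable trees at depth $0$. For $n\ge 0$ let $\mathrm{BT}_n$ be the set of those trees whose free variables belong to $V\cup\{x_1,\dots,x_n\}$. *Canonical terms.* Let $\Sigma_4$ be the CoLF$^\omega$ signature $$\begin{array}{l}\mathtt{ctm}:\mathsf{type},\ \mathtt{spine}:\mathsf{type},\ \mathtt{ntm}:\mathsf{cotype},\ \mathtt{vars}:\mathsf{type},\ \mathtt{consts}:\mathsf{type},\\ \mathtt{lam}:(\mathtt{vars}\to\mathtt{ctm})\to\mathtt{ctm},\ \mathtt{base}:\mathtt{ntm}\to\mathtt{ctm},\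 \mathtt{varntm}:\mathtt{vars}\to\mathtt{spine}\to\mathtt{ntm},\\ \mathtt{constntm}:\mathtt{consts}\to\mathtt{spine}\to\mathtt{ntm},\ \mathtt{snil}:\mathtt{spine},\ \mathtt{scons}:\mathtt{ctm}\to\mathtt{spine}\to\mathtt{spine},\end{array}$$ together with declarations $v:\mathtt{vars}$ for $v\in V$ and $c:\mathtt{consts}$ for $c\in C$. An infinitary term is a coherent sequence of its observations at the finite depths, for the grammar $M_{(k+1)} ::= \lambda x.\,M_{(k+1)} \mid x\cdot(M_{(k+1)};\dots;M_{(k+1)}) \mid c\cdot(M_{(k)};\dots;M_{(k)})$, where every spine is finite. It has type $\mathtt{ctm}$ if all these observations check against $\mathtt{ctm}$ under the typing rules of CoLF$^\omega$ (bidirectional typing of $\beta$-normal $\eta$-long terms, in which terms of depth $0$ check against every type). A trace of a term $\lambda x_1\dots\lambda x_l.\,h\cdot(M_1;\dots;M_m)$ is $h$ followed, if $m>0$, by a trace of some $M_i$. A term is valid if along each of its infinite traces some coinductive constructor (one whose target type family is a $\mathsf{cotype}$) occurs infinitely often and has the highest priority among the constructors that occur infinitely often, where a constructor has the priority of its target type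 family and families declared later have higher priority. Let $\mathrm{CTM}_n$ be the set of valid infinitary terms of type $\mathtt{ctm}$ in the context $x_1:\mathtt{vars},\dots,x_n:\mathtt{vars}$. *Claim.* There are bijections $e_n:\mathrm{BT}_n\to\mathrm{CTM}_n$ for all $n\ge 0$ (in particular $e_0$, onto the valid infinitary canonical terms of type $\mathtt{ctm}$ in the empty context) such that $$e_n(\lambda x.\,M)=\mathtt{lam}\,(\lambda x.\,e_{n+1}(M)),$$ $$e_n(x\cdot(M_1;\dots;M_m))=\mathtt{base}\,(\mathtt{varntm}\;x\;S)\ \text{ for a variable } x,\qquad e_n(c\cdot(M_1;\dots;M_m))=\mathtt{base}\,(\mathtt{constntm}\;c\;S)\ \text{ for } c\in C,$$ where $S=\mathtt{scons}\,e_n(M_1)\,(\dots(\mathtt{scons}\,e_n(M_m)\,\mathtt{snil})\dots)$. -/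

import Mathlib

universe u v w

/-! ## Terms observed up to a finite depth -/

mutual
/-- `Tm κ k n`: canonical terms of observation depth `k` with constants from `κ` and free variables
among `n` de Bruijn indices (terms are taken up to renaming of bound variables). A term of depth `0`
is unobservable. The arguments of a variable are revealed in the same observation, the arguments of a
constant in the next one. The neutral terms are those built by `var` and `con`. -/
inductive Tm (κ : Type u) : ℕ → ℕ → Type u
  | unobs {n : ℕ} : Tm κ 0 n
  | lam {k n : ℕ} : Tm κ (k + 1) (n + 1) → Tm κ (k + 1) n
  | var {k n : ℕ} : Fin n → Sp κ (k + 1) n → Tm κ (k + 1) n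
  | con {k n : ℕ} : κ → Sp κ k n → Tm κ (k + 1) n
/-- `Sp κ d n`: finite spines all of whose entries have depth `d`. The continuing spines of depth
`k + 1` are `Sp κ (k + 1) n`, the suspended spines of depth `k + 1` are `Sp κ k n`. -/
inductive Sp (κ : Type u) : ℕ → ℕ → Type u
  | nil {d n : ℕ} : Sp κ d n
  | cons {d n : ℕ} : Tm κ d n → Sp κ d n → Sp κ d n
end

/-- Canonical types of depth `k` over the type family names `F`. -/
inductive Ty (F : Type v) (κ : Type u) : ℕ → ℕ → Type (max u v)
  | unobs {n : ℕ} : Ty F κ 0 n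
  | atom {k n : ℕ} : F → Sp κ k n → Ty F κ (k + 1) n
  | pi {k n : ℕ} : Ty F κ (k + 1) n → Ty F κ (k + 1) (n + 1) → Ty F κ (k + 1) n

/-- Kinds of depth `k`. -/
inductive Kd (F : Type v) (κ : Type u) : ℕ → ℕ → Type (max u v)
  | unobs {n : ℕ} : Kd F κ 0 n
  | type {k n : ℕ} : Kd F κ (k + 1) n
  | cotype {k n : ℕ} : Kd F κ (k + 1) n
  | pi {k n : ℕ} : Ty F κ (k + 1) n → Kd F κ (k + 1) (n + 1) → Kd F κ (k + 1) n

/-- Contexts of depth `k` declaring `n` variables; index `0` is the variable declared last. -/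
inductive Ctx (F : Type v) (κ : Type u) (k : ℕ) : ℕ → Type (max u v)
  | nil : Ctx F κ k 0
  | snoc {n : ℕ} : Ctx F κ k n → Ty F κ k n → Ctx F κ k (n + 1)

/-! ### Viewing an expression at the next smaller depth -/

mutual
def Tm.trunc {κ : Type u} : {k n : ℕ} → Tm κ (k + 1) n → Tm κ k n
  | 0, _, _ => .unobs
  | _ + 1, _, .lam M => .lam M.trunc
  | _ + 1, _, .var x T => .var x T.trunc
  | _ + 1, _, .con c S => .con c S.trunc
def Sp.trunc {κ : Type u} : {k n : ℕ} → Sp κ (k + 1) n → Sp κ k n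
  | _, _, .nil => .nil
  | _, _, .cons M S => .cons M.trunc S.trunc
end

def Ty.trunc {F : Type v} {κ : Type u} : {k n : ℕ} → Ty F κ (k + 1) n → Ty F κ k n
  | 0, _, _ => .unobs
  | _ + 1, _, .atom a S => .atom a S.trunc
  | _ + 1, _, .pi B A => .pi B.trunc A.trunc

def Kd.trunc {F : Type v} {κ : Type u} : {k n : ℕ} → Kd F κ (k + 1) n → Kd F κ k n
  | 0, _, _ => .unobs
  | _ + 1, _, .type => .type
  | _ + 1, _, .cotype => .cotype
  | _ + 1, _, .pi A K => .pi A.trunc K.trunc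

def Ctx.trunc {F : Type v} {κ : Type u} {k : ℕ} : {n : ℕ} → Ctx F κ (k + 1) n → Ctx F κ k n
  | _, .nil => .nil
  | _, .snoc Γ A => .snoc Γ.trunc A.trunc

/-! ### Renaming and weakening -/

/-- Extends a renaming under one binder. -/
def liftRen {n m : ℕ} (ρ : Fin n → Fin m) : Fin (n + 1) → Fin (m + 1) :=
  Fin.cases 0 (fun i => (ρ i).succ)

mutual
def Tm.rename {κ : Type u} : {k n m : ℕ} → (Fin n → Fin m) → Tm κ k n → Tm κ k m
  | _, _, _, _, .unobs => .unobs
  | _, _, _, ρ, .lam M => .lam (M.rename (liftRen ρ))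
  | _, _, _, ρ, .var x T => .var (ρ x) (T.rename ρ)
  | _, _, _, ρ, .con c S => .con c (S.rename ρ)
def Sp.rename {κ : Type u} : {k n m : ℕ} → (Fin n → Fin m) → Sp κ k n → Sp κ k m
  | _, _, _, _, .nil => .nil
  | _, _, _, ρ, .cons M S => .cons (M.rename ρ) (S.rename ρ)
end

def Ty.rename {F : Type v} {κ : Type u} :
    {k n m : ℕ} → (Fin n → Fin m) → Ty F κ k n → Ty F κ k m
  | _, _, _, _, .unobs => .unobs
  | _, _, _, ρ, .atom a S => .atom a (S.rename ρ)
  | _, _, _, ρ, .pi B A => .pi (B.rename ρ) (A.rename (liftRen ρ))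

def Tm.weaken {κ : Type u} {k n : ℕ} (M : Tm κ k n) : Tm κ k (n + 1) := M.rename Fin.succ

def Ty.weaken {F : Type v} {κ : Type u} {k n : ℕ} (A : Ty F κ k n) : Ty F κ k (n + 1) :=
  A.rename Fin.succ

/-- A closed type viewed in an arbitrary scope. -/
def Ty.ofClosed {F : Type v} {κ : Type u} {k n : ℕ} (A : Ty F κ k 0) : Ty F κ k n :=
  A.rename Fin.elim0

/-- The type of a variable declared in a context. -/
def Ctx.lookup {F : Type v} {κ : Type u} {k : ℕ} : {n : ℕ} → Ctx F κ k n → Fin n → Ty F κ k n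
  | _, .nil => Fin.elim0
  | _, .snoc Γ A => Fin.cases A.weaken (fun i => (Γ.lookup i).weaken)

/-! ### Hereditary substitution -/

/-- Simple types over one base type `*`. -/
inductive Simple
  | base : Simple
  | arr : Simple → Simple → Simple

/-- Erasure of a canonical type to a simple type. Only types of positive depth are ever erased. -/
def Ty.erase {F : Type v} {κ : Type u} : {k n : ℕ} → Ty F κ k n → Simple
  | _, _, .unobs => .base
  | _, _, .atom _ _ => .base
  | _, _, .pi B A => .arr B.erase A.erase

def Tm.IsNeutral {κ : Type u} : {k n : ℕ} → Tm κ k n → Prop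
  | _, _, .unobs => False
  | _, _, .lam _ => False
  | _, _, .var _ _ => True
  | _, _, .con _ _ => True

mutual
/-- `HSubst τ i N M M'` is the judgment `[N/i]^τ M = M'`; the variables of `M` other than `i` are
those of the form `i.succAbove j`, and become `j` in `M'`. -/
inductive HSubst {κ : Type u} :
    {k n : ℕ} → Simple → Fin (n + 1) → Tm κ k n → Tm κ k (n + 1) → Tm κ k n → Prop
  | unobs {n : ℕ} {τ : Simple} {i : Fin (n + 1)} {N : Tm κ 0 n} : HSubst τ i N .unobs .unobs
  | lam {k n : ℕ} {τ : Simple} {i : Fin (n + 1)} {N : Tm κ (k + 1) n}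
      {M : Tm κ (k + 1) (n + 2)} {M' : Tm κ (k + 1) (n + 1)} :
      HSubst τ i.succ N.weaken M M' → HSubst τ i N (.lam M) (.lam M')
  | varSame {k n : ℕ} {τ : Simple} {i : Fin (n + 1)} {N : Tm κ (k + 1) n}
      {T : Sp κ (k + 1) (n + 1)} {T' : Sp κ (k + 1) n} {N' : Tm κ (k + 1) n} :
      HSubstSp τ i N T T' → SpApp T' τ N N' → HSubst τ i N (.var i T) N'
  | varOther {k n : ℕ} {τ : Simple} {i : Fin (n + 1)} {N : Tm κ (k + 1) n}
      {j : Fin n} {T : Sp κ (k + 1) (n + 1)} {T' : Sp κ (k + 1) n} :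
      HSubstSp τ i N T T' → HSubst τ i N (.var (i.succAbove j) T) (.var j T')
  | con {k n : ℕ} {τ : Simple} {i : Fin (n + 1)} {N : Tm κ (k + 1) n}
      {c : κ} {S : Sp κ k (n + 1)} {S' : Sp κ k n} :
      HSubstSp τ i N.trunc S S' → HSubst τ i N (.con c S) (.con c S')
/-- Hereditary substitution in (continuing or suspended) spines. -/
inductive HSubstSp {κ : Type u} :
    {k n : ℕ} → Simple → Fin (n + 1) → Tm κ k n → Sp κ k (n + 1) → Sp κ k n → Prop
  | nil {k n : ℕ} {τ : Simple} {i : Fin (n + 1)} {N : Tm κ k n} : HSubstSp τ i N .nil .nil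
  | cons {k n : ℕ} {τ : Simple} {i : Fin (n + 1)} {N : Tm κ k n}
      {M : Tm κ k (n + 1)} {M' : Tm κ k n} {S : Sp κ k (n + 1)} {S' : Sp κ k n} :
      HSubst τ i N M M' → HSubstSp τ i N S S' → HSubstSp τ i N (.cons M S) (.cons M' S')
/-- `SpApp T τ N R` is the judgment `T ▷^τ N = R`. -/
inductive SpApp {κ : Type u} :
    {k n : ℕ} → Sp κ (k + 1) n → Simple → Tm κ (k + 1) n → Tm κ (k + 1) n → Prop
  | nil {k n : ℕ} {R : Tm κ (k + 1) n} : R.IsNeutral → SpApp .nil .base R R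
  | cons {k n : ℕ} {τ₁ τ₂ : Simple} {N : Tm κ (k + 1) n} {T : Sp κ (k + 1) n}
      {M : Tm κ (k + 1) (n + 1)} {M' M'' : Tm κ (k + 1) n} :
      HSubst τ₂ 0 N M M' → SpApp T τ₁ M' M'' → SpApp (.cons N T) (.arr τ₂ τ₁) (.lam M) M''
end

/-- Hereditary substitution of a term of depth `k` into a type of depth `k + 1`. -/
inductive HSubstTy {F : Type v} {κ : Type u} {k : ℕ} : {n : ℕ} → Simple → Fin (n + 1) →
    Tm κ k n → Ty F κ (k + 1) (n + 1) → Ty F κ (k + 1) n → Prop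
  | atom {n : ℕ} {τ : Simple} {i : Fin (n + 1)} {N : Tm κ k n} {a : F}
      {S : Sp κ k (n + 1)} {S' : Sp κ k n} :
      HSubstSp τ i N S S' → HSubstTy τ i N (.atom a S) (.atom a S')
  | pi {n : ℕ} {τ : Simple} {i : Fin (n + 1)} {N : Tm κ k n}
      {B : Ty F κ (k + 1) (n + 1)} {B' : Ty F κ (k + 1) n}
      {A : Ty F κ (k + 1) (n + 2)} {A' : Ty F κ (k + 1) (n + 1)} :
      HSubstTy τ i N B B' → HSubstTy τ i.succ N.weaken A A' → HSubstTy τ i N (.pi B A) (.pi B' A')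

/-! ## Infinitary expressions: coherent sequences of observations -/

/-- A term of depth `ω`: its partial observations at all finite depths. -/
@[ext]
structure ITm (κ : Type u) (n : ℕ) where
  obs : (k : ℕ) → Tm κ k n
  coherent : ∀ k, (obs (k + 1)).trunc = obs k

structure ITy (F : Type v) (κ : Type u) (n : ℕ) where
  obs : (k : ℕ) → Ty F κ k n
  coherent : ∀ k, (obs (k + 1)).trunc = obs k

structure IKd (F : Type v) (κ : Type u) (n : ℕ) where
  obs : (k : ℕ) → Kd F κ k n
  coherent : ∀ k, (obs (k + 1)).trunc = obs k

inductive ICtx (F : Type v) (κ : Type u) : ℕ → Type (max u v)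
  | nil : ICtx F κ 0
  | snoc {n : ℕ} : ICtx F κ n → ITy F κ n → ICtx F κ (n + 1)

def ICtx.obs {F : Type v} {κ : Type u} : {n : ℕ} → ICtx F κ n → (k : ℕ) → Ctx F κ k n
  | _, .nil, _ => .nil
  | _, .snoc Γ A, k => .snoc (Γ.obs k) (A.obs k)

def Sp.ofList {κ : Type u} {d n : ℕ} : List (Tm κ d n) → Sp κ d n
  | [] => .nil
  | M :: Ms => .cons M (Sp.ofList Ms)

theorem Sp.trunc_ofList {κ : Type u} {k n : ℕ} (L : List (ITm κ n)) :
    (Sp.ofList (L.map fun N => N.obs (k + 1))).trunc = Sp.ofList (L.map fun N => N.obs k) := by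
  induction L with
  | nil => simp [Sp.ofList, Sp.trunc]
  | cons N L ih => simp [Sp.ofList, Sp.trunc, ih, N.coherent]

/-- `λ x. M` for an infinitary term `M`. -/
def ITm.lam {κ : Type u} {n : ℕ} (M : ITm κ (n + 1)) : ITm κ n where
  obs
    | 0 => .unobs
    | k + 1 => .lam (M.obs (k + 1))
  coherent
    | 0 => by simp [Tm.trunc]
    | k + 1 => by simp [Tm.trunc, M.coherent]

/-- `x · (N₁; …; Nₘ)` for infinitary terms `Nᵢ`. -/
def ITm.var {κ : Type u} {n : ℕ} (x : Fin n) (args : List (ITm κ n)) : ITm κ n where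
  obs
    | 0 => .unobs
    | k + 1 => .var x (Sp.ofList (args.map fun N => N.obs (k + 1)))
  coherent
    | 0 => by simp [Tm.trunc]
    | k + 1 => by simp only [Tm.trunc, Sp.trunc_ofList]

/-- `c · (N₁; …; Nₘ)` for infinitary terms `Nᵢ`. -/
def ITm.con {κ : Type u} {n : ℕ} (c : κ) (args : List (ITm κ n)) : ITm κ n where
  obs
    | 0 => .unobs
    | k + 1 => .con c (Sp.ofList (args.map fun N => N.obs k))
  coherent
    | 0 => by simp [Tm.trunc]
    | k + 1 => by simp only [Tm.trunc, Sp.trunc_ofList]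

/-! ## Signatures and type checking -/

/-- An infinitary signature declaring the type families `F` and the constants `κ`. The declaration
order matters only through the priorities of the type families: families declared later have higher
priority. -/
structure Signature (F : Type v) (κ : Type u) where
  kind : F → IKd F κ 0
  type : κ → ITy F κ 0
  priority : F → ℕ

section Typing

variable {F : Type v} {κ : Type u} (Sg : Signature F κ)

mutual
/-- `Γ ⊢ M ⇐ A`. -/
inductive Check : {k n : ℕ} → Ctx F κ k n → Tm κ k n → Ty F κ k n → Prop
  | unobs {n : ℕ} {Γ : Ctx F κ 0 n} {A : Ty F κ 0 n} : Check Γ .unobs A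
  | neutral {k n : ℕ} {Γ : Ctx F κ (k + 1) n} {R : Tm κ (k + 1) n} {a : F} {S : Sp κ k n} :
      Synth Γ R (.atom a S) → Check Γ R (.atom a S)
  | lam {k n : ℕ} {Γ : Ctx F κ (k + 1) n} {M : Tm κ (k + 1) (n + 1)}
      {B : Ty F κ (k + 1) n} {A : Ty F κ (k + 1) (n + 1)} :
      Check (Γ.snoc B) M A → Check Γ (.lam M) (.pi B A)
/-- `Γ ⊢ R ⇒ P` for neutral terms `R`. -/
inductive Synth : {k n : ℕ} → Ctx F κ (k + 1) n → Tm κ (k + 1) n → Ty F κ (k + 1) n → Prop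
  | var {k n : ℕ} {Γ : Ctx F κ (k + 1) n} {x : Fin n} {T : Sp κ (k + 1) n}
      {P : Ty F κ (k + 1) n} :
      TSpine Γ T (Γ.lookup x) P → Synth Γ (.var x T) P
  | con {k n : ℕ} {Γ : Ctx F κ (k + 1) n} {c : κ} {S : Sp κ k n} {P : Ty F κ (k + 1) n} :
      SSpine Γ S (Ty.ofClosed ((Sg.type c).obs (k + 1))) P → Synth Γ (.con c S) P
/-- `Γ ⊢ T ▷ A ⇒ P` for continuing spines `T`. -/
inductive TSpine : {k n : ℕ} → Ctx F κ (k + 1) n → Sp κ (k + 1) n → Ty F κ (k + 1) n →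
    Ty F κ (k + 1) n → Prop
  | nil {k n : ℕ} {Γ : Ctx F κ (k + 1) n} {a : F} {S : Sp κ k n} :
      TSpine Γ .nil (.atom a S) (.atom a S)
  | cons {k n : ℕ} {Γ : Ctx F κ (k + 1) n} {M : Tm κ (k + 1) n} {T : Sp κ (k + 1) n}
      {B : Ty F κ (k + 1) n} {A : Ty F κ (k + 1) (n + 1)} {A' P : Ty F κ (k + 1) n} :
      Check Γ M B → HSubstTy B.erase 0 M.trunc A A' → TSpine Γ T A' P →
      TSpine Γ (.cons M T) (.pi B A) P
/-- `Γ ⊢ S ▷ A ⇒ P` for suspended spines `S`, whose entries are checked at the smaller depth. -/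
inductive SSpine : {k n : ℕ} → Ctx F κ (k + 1) n → Sp κ k n → Ty F κ (k + 1) n →
    Ty F κ (k + 1) n → Prop
  | nil {k n : ℕ} {Γ : Ctx F κ (k + 1) n} {a : F} {S : Sp κ k n} :
      SSpine Γ .nil (.atom a S) (.atom a S)
  | cons {k n : ℕ} {Γ : Ctx F κ (k + 1) n} {M : Tm κ k n} {S : Sp κ k n}
      {B : Ty F κ (k + 1) n} {A : Ty F κ (k + 1) (n + 1)} {A' P : Ty F κ (k + 1) n} :
      Check Γ.trunc M B.trunc → HSubstTy B.erase 0 M A A' → SSpine Γ S A' P →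
      SSpine Γ (.cons M S) (.pi B A) P
end

end Typing

/-! ## Traces, validity, infinitary canonical terms -/

/-- An entry of a trace: a constant, or some variable (whose identity validity does not need). -/
inductive TraceHead (κ : Type u) : Type u
  | variable : TraceHead κ
  | const : κ → TraceHead κ

/-- `TraceStep M h N`: `M = λ x₁ … λ xₗ. h · (M₁; …; Mₘ)` and `N` is one of the `Mᵢ`. -/
inductive TraceStep {κ : Type u} : (Σ n, ITm κ n) → TraceHead κ → (Σ n, ITm κ n) → Prop
  | var {n : ℕ} {x : Fin n} {args : List (ITm κ n)} {N : ITm κ n} :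
      N ∈ args → TraceStep ⟨n, ITm.var x args⟩ .variable ⟨n, N⟩
  | con {n : ℕ} {c : κ} {args : List (ITm κ n)} {N : ITm κ n} :
      N ∈ args → TraceStep ⟨n, ITm.con c args⟩ (.const c) ⟨n, N⟩
  | lam {n : ℕ} {M : ITm κ (n + 1)} {h : TraceHead κ} {N : Σ m, ITm κ m} :
      TraceStep ⟨n + 1, M⟩ h N → TraceStep ⟨n, ITm.lam M⟩ h N

/-- `t` is (the sequence of heads along) an infinite trace of `M`. -/
def IsInfiniteTrace {κ : Type u} {n : ℕ} (M : ITm κ n) (t : ℕ → TraceHead κ) : Prop :=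
  ∃ f : ℕ → Σ m, ITm κ m, f 0 = ⟨n, M⟩ ∧ ∀ i, TraceStep (f i) (t i) (f (i + 1))

/-- The constant `c` occurs infinitely often along `t`. -/
def OccursInfinitelyOften {κ : Type u} (t : ℕ → TraceHead κ) (c : κ) : Prop :=
  ∃ᶠ i in Filter.atTop, t i = .const c

/-- The kind ends in `cotype`. -/
def Kd.IsCo {F : Type v} {κ : Type u} : {k n : ℕ} → Kd F κ k n → Prop
  | _, _, .unobs => False
  | _, _, .type => False
  | _, _, .cotype => True
  | _, _, .pi _ K => K.IsCo

/-- `A` has the form `Π x₁ … Π xₘ. a · S`. -/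
def Ty.Targets {F : Type v} {κ : Type u} (a : F) : {k n : ℕ} → Ty F κ k n → Prop
  | _, _, .unobs => False
  | _, _, .atom b _ => b = a
  | _, _, .pi _ A => A.Targets a

/-- `c` is a constructor of the type family `a`. -/
def Signature.Constructs {F : Type v} {κ : Type u} (Sg : Signature F κ) (c : κ) (a : F) : Prop :=
  ((Sg.type c).obs 1).Targets a

/-- The type family `a` is coinductive. -/
def Signature.Coinductive {F : Type v} {κ : Type u} (Sg : Signature F κ) (a : F) : Prop :=
  ((Sg.kind a).obs 1).IsCo

/-- Along every infinite trace, some coinductive constructor occurs infinitely often and has the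
highest priority among the constructors that occur infinitely often. Constructors have the priority
of the type family that they construct. -/
def TraceValid {F : Type v} {κ : Type u} (Sg : Signature F κ) {n : ℕ} (M : ITm κ n) : Prop :=
  ∀ t : ℕ → TraceHead κ, IsInfiniteTrace M t →
    ∃ (c : κ) (a : F), Sg.Constructs c a ∧ Sg.Coinductive a ∧ OccursInfinitelyOften t c ∧
      ∀ (c' : κ) (a' : F), Sg.Constructs c' a' → OccursInfinitelyOften t c' →
        Sg.priority a' ≤ Sg.priority a

/-- `M` is an infinitary canonical term of type `A` in the context `Γ`: all its partial observations
type check, and it is valid. -/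
def IsCanonicalTerm {F : Type v} {κ : Type u} (Sg : Signature F κ) {n : ℕ}
    (Γ : ICtx F κ n) (M : ITm κ n) (A : ITy F κ n) : Prop :=
  (∀ k, Check Sg (Γ.obs k) (M.obs k) (A.obs k)) ∧ TraceValid Sg M

/-! ## The signature of ⊥-free Böhm trees -/

/-- The atomic type `a · ()`. -/
def ITy.base {F : Type v} {κ : Type u} {n : ℕ} (a : F) : ITy F κ n where
  obs
    | 0 => .unobs
    | _ + 1 => .atom a .nil
  coherent
    | 0 => by simp [Ty.trunc]
    | _ + 1 => by simp [Ty.trunc, Sp.trunc]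

/-- The type `Π x : B. A`. When `A` does not mention `x`, this is `B → A`. -/
def ITy.pi {F : Type v} {κ : Type u} {n : ℕ} (B : ITy F κ n) (A : ITy F κ (n + 1)) :
    ITy F κ n where
  obs
    | 0 => .unobs
    | k + 1 => .pi (B.obs (k + 1)) (A.obs (k + 1))
  coherent
    | 0 => by simp [Ty.trunc]
    | _ + 1 => by simp [Ty.trunc, B.coherent, A.coherent]

def IKd.type {F : Type v} {κ : Type u} {n : ℕ} : IKd F κ n where
  obs
    | 0 => .unobs
    | _ + 1 => .type
  coherent
    | 0 => by simp [Kd.trunc]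
    | _ + 1 => by simp [Kd.trunc]

def IKd.cotype {F : Type v} {κ : Type u} {n : ℕ} : IKd F κ n where
  obs
    | 0 => .unobs
    | _ + 1 => .cotype
  coherent
    | 0 => by simp [Kd.trunc]
    | _ + 1 => by simp [Kd.trunc]

/-- The type families of the signature. -/
inductive Fam4
  | ctm | spine | ntm | vars | consts

/-- The constants of the signature; besides the six constructors, each element of the distinguished
set `V` of variables is declared with type `vars`, and each element of the distinguished set `C` of
constants with type `consts`. -/
inductive Con4 (V : Type u) (C : Type v) : Type (max u v)
  | lam | base | varntm | constntm | snil | scons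
  | free : V → Con4 V C
  | const : C → Con4 V C

def Sigma4 (V : Type u) (C : Type v) : Signature Fam4 (Con4 V C) where
  kind
    | .ctm => .type
    | .spine => .type
    | .ntm => .cotype
    | .vars => .type
    | .consts => .type
  type
    | .lam => .pi (.pi (.base .vars) (.base .ctm)) (.base .ctm)
    | .base => .pi (.base .ntm) (.base .ctm)
    | .varntm => .pi (.base .vars) (.pi (.base .spine) (.base .ntm))
    | .constntm => .pi (.base .consts) (.pi (.base .spine) (.base .ntm))
    | .snil => .base .spine
    | .scons => .pi (.base .ctm) (.pi (.base .spine) (.base .spine))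
    | .free _ => .base .vars
    | .const _ => .base .consts
  priority
    | .ctm => 0
    | .spine => 1
    | .ntm => 2
    | .vars => 3
    | .consts => 4

/-- The context `x₁ : vars, …, xₙ : vars`. -/
def varsCtx (V : Type u) (C : Type v) : (n : ℕ) → ICtx Fam4 (Con4 V C) n
  | 0 => .nil
  | n + 1 => .snoc (varsCtx V C n) (.base .vars)

/-- The infinitary canonical terms of type `ctm` in the context `x₁ : vars, …, xₙ : vars`; for
`n = 0` the closed ones. -/
def CtmTerm (V : Type u) (C : Type v) (n : ℕ) : Type (max u v) :=
  {M : ITm (Con4 V C) n // IsCanonicalTerm (Sigma4 V C) (varsCtx V C n) M (.base .ctm)}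

/-! ## ⊥-free Böhm trees -/

/-- Heads: one of `n` variables given by a de Bruijn index, a named free variable, a constant. -/
inductive BHead (V : Type u) (C : Type v) (n : ℕ) : Type (max u v)
  | var : Fin n → BHead V C n
  | free : V → BHead V C n
  | const : C → BHead V C n

mutual
/-- ⊥-free Böhm trees of depth `k`, in head-spine form: one observation reveals all leading
abstractions, the head and the number of arguments; the arguments are observed in the next one. -/
inductive BT (V : Type u) (C : Type v) : ℕ → ℕ → Type (max u v)
  | unobs {n : ℕ} : BT V C 0 n
  | lam {k n : ℕ} : BT V C (k + 1) (n + 1) → BT V C (k + 1) n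
  | app {k n : ℕ} : BHead V C n → BSp V C k n → BT V C (k + 1) n
/-- Finite lists of trees of depth `k`. -/
inductive BSp (V : Type u) (C : Type v) : ℕ → ℕ → Type (max u v)
  | nil {k n : ℕ} : BSp V C k n
  | cons {k n : ℕ} : BT V C k n → BSp V C k n → BSp V C k n
end

mutual
def BT.trunc {V : Type u} {C : Type v} : {k n : ℕ} → BT V C (k + 1) n → BT V C k n
  | 0, _, _ => .unobs
  | _ + 1, _, .lam M => .lam M.trunc
  | _ + 1, _, .app h S => .app h S.trunc
def BSp.trunc {V : Type u} {C : Type v} : {k n : ℕ} → BSp V C (k + 1) n → BSp V C k n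
  | _, _, .nil => .nil
  | _, _, .cons M S => .cons M.trunc S.trunc
end

/-- ⊥-free Böhm trees (not necessarily productive) whose free variables are among `n` de Bruijn
indices and `V`, and whose constants are among `C`. -/
@[ext]
structure BohmTree (V : Type u) (C : Type v) (n : ℕ) where
  obs : (k : ℕ) → BT V C k n
  coherent : ∀ k, (obs (k + 1)).trunc = obs k

def BSp.ofList {V : Type u} {C : Type v} {k n : ℕ} : List (BT V C k n) → BSp V C k n
  | [] => .nil
  | M :: Ms => .cons M (BSp.ofList Ms)

theorem BSp.trunc_ofList {V : Type u} {C : Type v} {k n : ℕ} (L : List (BohmTree V C n)) :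
    (BSp.ofList (L.map fun N => N.obs (k + 1))).trunc = BSp.ofList (L.map fun N => N.obs k) := by
  induction L with
  | nil => simp [BSp.ofList, BSp.trunc]
  | cons N L ih => simp [BSp.ofList, BSp.trunc, ih, N.coherent]

/-- The tree `λ x. M`. -/
def BohmTree.lam {V : Type u} {C : Type v} {n : ℕ} (M : BohmTree V C (n + 1)) :
    BohmTree V C n where
  obs
    | 0 => .unobs
    | k + 1 => .lam (M.obs (k + 1))
  coherent
    | 0 => by simp [BT.trunc]
    | k + 1 => by simp [BT.trunc, M.coherent]

/-- The tree `h · (M₁; …; Mₘ)`. -/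
def BohmTree.app {V : Type u} {C : Type v} {n : ℕ} (h : BHead V C n)
    (args : List (BohmTree V C n)) : BohmTree V C n where
  obs
    | 0 => .unobs
    | k + 1 => .app h (BSp.ofList (args.map fun N => N.obs k))
  coherent
    | 0 => by simp [BT.trunc]
    | k + 1 => by simp only [BT.trunc, BSp.trunc_ofList]

/-! ## The clauses of the encoding -/

/-- `lam ([x] M)`. -/
def encLam {V : Type u} {C : Type v} {n : ℕ} (M : ITm (Con4 V C) (n + 1)) : ITm (Con4 V C) n :=
  .con .lam [.lam M]

/-- `scons M₁ (scons M₂ (… snil))`. -/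
def encSpine {V : Type u} {C : Type v} {n : ℕ} : List (ITm (Con4 V C) n) → ITm (Con4 V C) n
  | [] => .con .snil []
  | M :: Ms => .con .scons [M, encSpine Ms]

/-- `base (varntm x S)` or `base (constntm c S)`. -/
def encApp {V : Type u} {C : Type v} {n : ℕ} (h : BHead V C n) (S : ITm (Con4 V C) n) :
    ITm (Con4 V C) n :=
  .con .base [match h with
    | .var x => .con .varntm [.var x [], S]
    | .free x => .con .varntm [.con (.free x) [], S]
    | .const c => .con .constntm [.con (.const c) [], S]]

-- A Böhm tree has a finite root node: some abstractions, a head, and a finite list of subtrees.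
-- `Node` is inductive in the abstractions and lists the arguments, so it captures this finiteness.
-- `Node.toTree` is a bijection from nodes over trees to trees, and trees behave as a final
-- coalgebra for `Node` (`treeUnfold_eq`, `tree_unique`).
--
-- On the other side, `Node.encode` writes one node in the constructors of the signature. It is
-- injective and guarded: every constant uses up one observation, so depth `k + 1` of an encoded
-- node depends only on depth `k` of its arguments (`Node.encode_obs_congr`). Hence every coalgebra
-- of nodes has exactly one encoding (`encodeUnfold_eq`, `encode_unique`).
--
-- What remains is that canonical terms are exactly the terms that arise in this way. An encoding is
-- well typed depth by depth. It is valid because node abstractions and spines are finite, so an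
-- infinite trace meets `varntm` or `constntm` again and again; the families `vars` and `consts` of
-- higher priority have only constructors without arguments, which lie on no infinite trace.
-- Conversely, typing forces the shape of a term layer by layer, and validity forbids an infinite
-- run of `lam` or of `scons`, whose families are inductive; so a canonical term is an encoded node
-- with canonical arguments (`exists_node`).
--
-- Decoding unfolds these nodes into a tree. Both composites with the encoding solve the same
-- corecursive equation as the identity, and solutions are unique.

universe w'

/-! ## Case analysis for infinitary terms -/

section ITm

variable {κ : Type u} {n : ℕ}

/-- The number of entries of a spine. -/
def Sp.length : {d n : ℕ} → Sp κ d n → ℕ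
  | _, _, .nil => 0
  | _, _, .cons _ S => S.length + 1

theorem Sp.length_trunc (m : ℕ) : ∀ {k n : ℕ} (S : Sp κ (k + 1) n), S.length = m →
    S.trunc.length = m := by
  induction m with
  | zero => intro k n S h; cases S <;> simp_all [Sp.length, Sp.trunc]
  | succ m ih => intro k n S h; cases S <;> simp_all [Sp.length, Sp.trunc]

/-- A coherent sequence of spines is a list of infinitary terms. -/
theorem Sp.exists_list_of_coherent (S : ∀ k, Sp κ k n) (hS : ∀ k, (S (k + 1)).trunc = S k) :
    ∃ L : List (ITm κ n), ∀ k, S k = Sp.ofList (L.map fun N => N.obs k) := by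
  -- Truncation preserves the number of entries, so one length serves all depths and induction on it
  -- is possible.
  have hlen : ∀ k, (S k).length = (S 0).length := by
    intro k
    induction k with
    | zero => rfl
    | succ k ih => rw [← ih, ← hS k, Sp.length_trunc _ _ rfl]
  generalize (S 0).length = m at hlen
  induction m generalizing S with
  | zero =>
    refine ⟨[], fun k => ?_⟩
    have := hlen k
    cases h : S k <;> simp_all [Sp.length, Sp.ofList]
  | succ m ih =>
    have hex : ∀ k, ∃ M T, S k = .cons M T := by
      intro k
      have := hlen k
      cases h : S k
      · simp [h, Sp.length] at this
      · exact ⟨_, _, rfl⟩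
    choose M T hMT using hex
    have hc : ∀ k, (M (k + 1)).trunc = M k ∧ (T (k + 1)).trunc = T k := by
      intro k
      have := hS k
      rw [hMT, hMT, Sp.trunc] at this
      exact Sp.cons.inj this
    obtain ⟨L, hL⟩ := ih T (fun k => (hc k).2) (fun k => by
      have := hlen k
      rw [hMT, Sp.length] at this
      omega)
    refine ⟨⟨M, fun k => (hc k).1⟩ :: L, fun k => ?_⟩
    rw [hMT, hL]
    rfl

theorem ITm.obs_zero (M : ITm κ n) : M.obs 0 = .unobs := by
  cases M.obs 0
  rfl

theorem ITm.ext_succ {M N : ITm κ n} (h : ∀ k, M.obs (k + 1) = N.obs (k + 1)) : M = N := by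
  ext k
  cases k with
  | zero => rw [M.obs_zero, N.obs_zero]
  | succ k => rw [h]

/-- Every infinitary term is an abstraction, or has a variable or a constant as its head. -/
theorem ITm.cases (M : ITm κ n) : (∃ M', M = .lam M') ∨ (∃ x args, M = .var x args) ∨
    ∃ c args, M = .con c args := by
  cases h1 : M.obs 1 with
  | lam M₁ =>
    -- Truncation between positive depths preserves the outermost constructor, so depth 1 fixes it
    -- for all depths.
    have hex : ∀ k, ∃ M', M.obs (k + 1) = .lam M' := by
      intro k
      induction k with
      | zero => exact ⟨_, h1⟩
      | succ k ih =>
        obtain ⟨M', hM'⟩ := ih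
        have hk := M.coherent (k + 1)
        rw [hM'] at hk
        cases h : M.obs (k + 1 + 1) with
        | lam M'' => exact ⟨_, rfl⟩
        | var x T => simp [h, Tm.trunc] at hk
        | con c S => simp [h, Tm.trunc] at hk
    choose M' hM' using hex
    have hc : ∀ k, (M' (k + 1)).trunc = M' k := by
      intro k
      have := M.coherent (k + 1)
      rw [hM', hM', Tm.trunc] at this
      exact Tm.lam.inj this
    refine .inl ⟨⟨fun | 0 => .unobs | k + 1 => M' k, ?_⟩, ITm.ext_succ fun k => hM' k⟩
    rintro (_ | k)
    · simp [Tm.trunc]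
    · exact hc k
  | var x T₁ =>
    have hex : ∀ k, ∃ T, M.obs (k + 1) = .var x T := by
      intro k
      induction k with
      | zero => exact ⟨_, h1⟩
      | succ k ih =>
        obtain ⟨M', hM'⟩ := ih
        have hk := M.coherent (k + 1)
        rw [hM'] at hk
        cases h : M.obs (k + 1 + 1) with
        | lam M'' => simp [h, Tm.trunc] at hk
        | var y T =>
          rw [h, Tm.trunc] at hk
          cases (Tm.var.inj hk).1
          exact ⟨_, rfl⟩
        | con c S => simp [h, Tm.trunc] at hk
    choose T hT using hex
    have hc : ∀ k, (T (k + 1)).trunc = T k := by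
      intro k
      have := M.coherent (k + 1)
      rw [hT, hT, Tm.trunc] at this
      exact (Tm.var.inj this).2
    -- Arguments of a variable are seen at the same depth as the variable, so `T k` has depth `k +
    -- 1`; the missing depth 0 is filled in by truncation.
    obtain ⟨L, hL⟩ := Sp.exists_list_of_coherent
      (fun k => match k with | 0 => (T 0).trunc | k + 1 => T k) (by
        rintro (_ | k)
        · rfl
        · exact hc k)
    refine .inr (.inl ⟨x, L, ITm.ext_succ fun k => ?_⟩)
    rw [hT]
    exact congrArg _ (hL (k + 1))
  | con c S₁ =>
    have hex : ∀ k, ∃ S, M.obs (k + 1) = .con c S := by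
      intro k
      induction k with
      | zero => exact ⟨_, h1⟩
      | succ k ih =>
        obtain ⟨M', hM'⟩ := ih
        have hk := M.coherent (k + 1)
        rw [hM'] at hk
        cases h : M.obs (k + 1 + 1) with
        | lam M'' => simp [h, Tm.trunc] at hk
        | var y T => simp [h, Tm.trunc] at hk
        | con c S =>
          rw [h, Tm.trunc] at hk
          cases (Tm.con.inj hk).1
          exact ⟨_, rfl⟩
    choose S hS using hex
    have hc : ∀ k, (S (k + 1)).trunc = S k := by
      intro k
      have := M.coherent (k + 1)
      rw [hS, hS, Tm.trunc] at this
      exact (Tm.con.inj this).2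
    obtain ⟨L, hL⟩ := Sp.exists_list_of_coherent S hc
    refine .inr (.inr ⟨c, L, ITm.ext_succ fun k => ?_⟩)
    rw [hS]
    exact congrArg _ (hL k)

theorem Sp.ofList_injective {d : ℕ} : Function.Injective (Sp.ofList (κ := κ) (d := d) (n := n)) := by
  intro L
  induction L with
  | nil => rintro (_ | ⟨M, L⟩) h <;> simp_all [Sp.ofList]
  | cons M L ih =>
    rintro (_ | ⟨M', L'⟩) h
    · simp [Sp.ofList] at h
    · rw [Sp.ofList, Sp.ofList, Sp.cons.injEq] at h
      rw [h.1, ih h.2]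

theorem ITm.list_ext {L L' : List (ITm κ n)}
    (h : ∀ k, L.map (fun N => N.obs k) = L'.map fun N => N.obs k) : L = L' := by
  refine List.ext_getElem (by simpa using congrArg List.length (h 0)) fun i h₁ h₂ => ?_
  ext k
  have := List.getElem_of_eq (h k) (i := i) (by simpa using h₁)
  simpa using this

theorem ITm.lam_injective : Function.Injective (ITm.lam (κ := κ) (n := n)) :=
  fun _ _ h => ITm.ext_succ fun k => Tm.lam.inj (congrArg (fun M => M.obs (k + 1)) h)

theorem ITm.var_inj {x y : Fin n} {L L' : List (ITm κ n)} (h : ITm.var x L = .var y L') :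
    x = y ∧ L = L' := by
  have hk : ∀ k, x = y ∧ Sp.ofList (L.map fun N => N.obs (k + 1)) =
      Sp.ofList (L'.map fun N => N.obs (k + 1)) :=
    fun k => Tm.var.inj (congrArg (fun M => M.obs (k + 1)) h)
  refine ⟨(hk 0).1, ITm.list_ext fun k => ?_⟩
  cases k with
  -- The arguments are never exhibited at depth 0, but there all terms coincide and only the lengths
  -- matter.
  | zero =>
    have := congrArg List.length (Sp.ofList_injective (hk 0).2)
    simp only [List.length_map] at this
    simp [ITm.obs_zero, this]
  | succ k => exact Sp.ofList_injective (hk k).2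

theorem ITm.con_inj {c d : κ} {L L' : List (ITm κ n)} (h : ITm.con c L = .con d L') :
    c = d ∧ L = L' := by
  have hk : ∀ k, c = d ∧ Sp.ofList (L.map fun N => N.obs k) =
      Sp.ofList (L'.map fun N => N.obs k) :=
    fun k => Tm.con.inj (congrArg (fun M => M.obs (k + 1)) h)
  exact ⟨(hk 0).1, ITm.list_ext fun k => Sp.ofList_injective (hk k).2⟩

theorem ITm.lam_ne_var {M : ITm κ (n + 1)} {x : Fin n} {L : List (ITm κ n)} :
    ITm.lam M ≠ .var x L := fun h => by
  have := congrArg (fun M => M.obs 1) h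
  simp [ITm.lam, ITm.var] at this

theorem ITm.lam_ne_con {M : ITm κ (n + 1)} {c : κ} {L : List (ITm κ n)} :
    ITm.lam M ≠ .con c L := fun h => by
  have := congrArg (fun M => M.obs 1) h
  simp [ITm.lam, ITm.con] at this

theorem ITm.var_ne_con {x : Fin n} {L' : List (ITm κ n)} {c : κ} {L : List (ITm κ n)} :
    ITm.var x L' ≠ .con c L := fun h => by
  have := congrArg (fun M => M.obs 1) h
  simp [ITm.var, ITm.con] at this

end ITm

/-! ## Case analysis for Böhm trees -/

section BohmTree

variable {V : Type u} {C : Type v} {n : ℕ}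

/-- The number of entries of a list of trees. -/
def BSp.length : {d n : ℕ} → BSp V C d n → ℕ
  | _, _, .nil => 0
  | _, _, .cons _ S => S.length + 1

theorem BSp.length_trunc (m : ℕ) : ∀ {k n : ℕ} (S : BSp V C (k + 1) n), S.length = m →
    S.trunc.length = m := by
  induction m with
  | zero => intro k n S h; cases S <;> simp_all [BSp.length, BSp.trunc]
  | succ m ih => intro k n S h; cases S <;> simp_all [BSp.length, BSp.trunc]

/-- A coherent sequence of lists of finite observations is a list of trees. -/
theorem BSp.exists_list_of_coherent (S : ∀ k, BSp V C k n) (hS : ∀ k, (S (k + 1)).trunc = S k) :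
    ∃ L : List (BohmTree V C n), ∀ k, S k = BSp.ofList (L.map fun N => N.obs k) := by
  have hlen : ∀ k, (S k).length = (S 0).length := by
    intro k
    induction k with
    | zero => rfl
    | succ k ih => rw [← ih, ← hS k, BSp.length_trunc _ _ rfl]
  generalize (S 0).length = m at hlen
  induction m generalizing S with
  | zero =>
    refine ⟨[], fun k => ?_⟩
    have := hlen k
    cases h : S k <;> simp_all [BSp.length, BSp.ofList]
  | succ m ih =>
    have hex : ∀ k, ∃ M T, S k = .cons M T := by
      intro k
      have := hlen k
      cases h : S k
      · simp [h, BSp.length] at this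
      · exact ⟨_, _, rfl⟩
    choose M T hMT using hex
    have hc : ∀ k, (M (k + 1)).trunc = M k ∧ (T (k + 1)).trunc = T k := by
      intro k
      have := hS k
      rw [hMT, hMT, BSp.trunc] at this
      exact BSp.cons.inj this
    obtain ⟨L, hL⟩ := ih T (fun k => (hc k).2) (fun k => by
      have := hlen k
      rw [hMT, BSp.length] at this
      omega)
    refine ⟨⟨M, fun k => (hc k).1⟩ :: L, fun k => ?_⟩
    rw [hMT, hL]
    rfl

theorem BohmTree.obs_zero (M : BohmTree V C n) : M.obs 0 = .unobs := by
  cases M.obs 0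
  rfl

theorem BohmTree.ext_succ {M N : BohmTree V C n} (h : ∀ k, M.obs (k + 1) = N.obs (k + 1)) :
    M = N := by
  ext k
  cases k with
  | zero => rw [M.obs_zero, N.obs_zero]
  | succ k => rw [h]

/-- The equation `M'.obs 1 = M₁` lets the count of abstractions decrease in
`BohmTree.induction_lam`. -/
theorem BohmTree.eq_lam_of_obs_one {M : BohmTree V C n} {M₁ : BT V C 1 (n + 1)}
    (h1 : M.obs 1 = .lam M₁) : ∃ M' : BohmTree V C (n + 1), M'.obs 1 = M₁ ∧ M = .lam M' := by
  have hex : ∀ k, ∃ M', M.obs (k + 1) = .lam M' := by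
    intro k
    induction k with
    | zero => exact ⟨_, h1⟩
    | succ k ih =>
      obtain ⟨M', hM'⟩ := ih
      have hk := M.coherent (k + 1)
      rw [hM'] at hk
      cases h : M.obs (k + 1 + 1) with
      | lam M'' => exact ⟨_, rfl⟩
      | app c S => simp [h, BT.trunc] at hk
  choose M' hM' using hex
  have hc : ∀ k, (M' (k + 1)).trunc = M' k := by
    intro k
    have := M.coherent (k + 1)
    rw [hM', hM', BT.trunc] at this
    exact BT.lam.inj this
  refine ⟨⟨fun | 0 => .unobs | k + 1 => M' k, ?_⟩, ?_, BohmTree.ext_succ fun k => hM' k⟩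
  · rintro (_ | k)
    · simp [BT.trunc]
    · exact hc k
  · exact BT.lam.inj ((hM' 0).symm.trans h1)

theorem BohmTree.eq_app_of_obs_one {M : BohmTree V C n} {c : BHead V C n} {S₁ : BSp V C 0 n}
    (h1 : M.obs 1 = .app c S₁) : ∃ args, M = .app c args := by
  have hex : ∀ k, ∃ S, M.obs (k + 1) = .app c S := by
    intro k
    induction k with
    | zero => exact ⟨_, h1⟩
    | succ k ih =>
      obtain ⟨M', hM'⟩ := ih
      have hk := M.coherent (k + 1)
      rw [hM'] at hk
      cases h : M.obs (k + 1 + 1) with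
      | lam M'' => simp [h, BT.trunc] at hk
      | app c S =>
        rw [h, BT.trunc] at hk
        cases (BT.app.inj hk).1
        exact ⟨_, rfl⟩
  choose S hS using hex
  have hc : ∀ k, (S (k + 1)).trunc = S k := by
    intro k
    have := M.coherent (k + 1)
    rw [hS, hS, BT.trunc] at this
    exact (BT.app.inj this).2
  obtain ⟨L, hL⟩ := BSp.exists_list_of_coherent S hc
  refine ⟨L, BohmTree.ext_succ fun k => ?_⟩
  rw [hS]
  exact congrArg _ (hL k)

/-- The number of leading abstractions of a tree. -/
def BT.lams : {k n : ℕ} → BT V C k n → ℕ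
  | _, _, .unobs => 0
  | _, _, .lam M => M.lams + 1
  | _, _, .app _ _ => 0

/-- Induction on the leading abstractions of a tree. -/
theorem BohmTree.induction_lam {P : ∀ n, BohmTree V C n → Prop}
    (app : ∀ n h args, P n (.app h args)) (lam : ∀ n M, P (n + 1) M → P n (.lam M))
    (M : BohmTree V C n) : P n M := by
  -- Depth 1 already reveals every leading abstraction, so their finite number is available as a
  -- measure.
  generalize hm : (M.obs 1).lams = m
  induction m generalizing n with
  | zero =>
    cases h : M.obs 1 with
    | lam M₁ => simp [h, BT.lams] at hm
    | app c S =>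
      obtain ⟨args, rfl⟩ := M.eq_app_of_obs_one h
      exact app _ _ _
  | succ m ih =>
    cases h : M.obs 1 with
    | lam M₁ =>
      obtain ⟨M', h', rfl⟩ := M.eq_lam_of_obs_one h
      refine lam _ _ (ih _ ?_)
      rw [h, BT.lams] at hm
      rw [h']
      omega
    | app c S => simp [h, BT.lams] at hm

theorem BSp.ofList_injective {d : ℕ} :
    Function.Injective (BSp.ofList (V := V) (C := C) (k := d) (n := n)) := by
  intro L
  induction L with
  | nil => rintro (_ | ⟨M, L⟩) h <;> simp_all [BSp.ofList]
  | cons M L ih =>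
    rintro (_ | ⟨M', L'⟩) h
    · simp [BSp.ofList] at h
    · rw [BSp.ofList, BSp.ofList, BSp.cons.injEq] at h
      rw [h.1, ih h.2]

theorem BohmTree.lam_injective : Function.Injective (BohmTree.lam (V := V) (C := C) (n := n)) :=
  fun _ _ h => BohmTree.ext_succ fun k => BT.lam.inj (congrArg (fun M => M.obs (k + 1)) h)

theorem BohmTree.app_inj {x y : BHead V C n} {L L' : List (BohmTree V C n)}
    (h : BohmTree.app x L = .app y L') : x = y ∧ L = L' := by
  have hk : ∀ k, x = y ∧ BSp.ofList (L.map fun N => N.obs k) =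
      BSp.ofList (L'.map fun N => N.obs k) :=
    fun k => BT.app.inj (congrArg (fun M => M.obs (k + 1)) h)
  refine ⟨(hk 0).1, ?_⟩
  have hL := fun k => BSp.ofList_injective (hk k).2
  refine List.ext_getElem (by simpa using congrArg List.length (hL 0)) fun i h₁ h₂ => ?_
  ext k
  have := List.getElem_of_eq (hL k) (i := i) (by simpa using h₁)
  simpa using this

theorem BohmTree.lam_ne_app {M : BohmTree V C (n + 1)} {x : BHead V C n}
    {L : List (BohmTree V C n)} : BohmTree.lam M ≠ .app x L := fun h => by
  have := congrArg (fun M => M.obs 1) h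
  simp [BohmTree.lam, BohmTree.app] at this

end BohmTree

/-! ## Nodes of Böhm trees -/

/-- A node `λ x₁ … λ xₗ. h · (M₁; …; Mₘ)` whose arguments are elements of the family `X`. -/
inductive Node (V : Type u) (C : Type v) (X : ℕ → Type w) : ℕ → Type (max u v w)
  | lam {n : ℕ} : Node V C X (n + 1) → Node V C X n
  | app {n : ℕ} : BHead V C n → List (X n) → Node V C X n

section Node

variable {V : Type u} {C : Type v} {X : ℕ → Type w} {Y : ℕ → Type w'}

def Node.map (f : ∀ n, X n → Y n) : {n : ℕ} → Node V C X n → Node V C Y n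
  | _, .lam ν => .lam (ν.map f)
  | _, .app h args => .app h (args.map (f _))

theorem Node.map_map {Z : ℕ → Type*} (f : ∀ n, X n → Y n) (g : ∀ n, Y n → Z n) {n : ℕ}
    (ν : Node V C X n) : (ν.map f).map g = ν.map fun n x => g n (f n x) := by
  induction ν with
  | lam ν ih => simp [Node.map, ih]
  | app h args => simp [Node.map]

theorem Node.map_id {n : ℕ} (ν : Node V C X n) : ν.map (fun _ x => x) = ν := by
  induction ν with
  | lam ν ih => simp [Node.map, ih]
  | app h args => simp [Node.map]

theorem Node.map_injective {f : ∀ n, X n → Y n} (hf : ∀ n, Function.Injective (f n)) {n : ℕ} :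
    Function.Injective (Node.map (V := V) (C := C) f (n := n)) := by
  intro ν
  induction ν with
  | lam ν ih =>
    rintro (ν' | ⟨h', args'⟩) h
    · simp only [Node.map, Node.lam.injEq] at h
      rw [ih h]
    · simp [Node.map] at h
  | app h args =>
    rintro (ν' | ⟨h', args'⟩) h
    · simp [Node.map] at h
    · simp only [Node.map, Node.app.injEq] at h
      rw [h.1, (hf _).list_map h.2]

/-- The tree with the given root node. -/
def Node.toTree : {n : ℕ} → Node V C (BohmTree V C) n → BohmTree V C n
  | _, .lam ν => .lam ν.toTree
  | _, .app h args => .app h args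

/-- The encoding of a node whose arguments are encoded. -/
def Node.encode : {n : ℕ} → Node V C (ITm (Con4 V C)) n → ITm (Con4 V C) n
  | _, .lam ν => encLam ν.encode
  | _, .app h args => encApp h (encSpine args)

theorem Node.toTree_injective {n : ℕ} : Function.Injective (Node.toTree (V := V) (C := C) (n := n)) := by
  intro ν
  induction ν with
  | lam ν ih =>
    rintro (ν' | ⟨h', args'⟩) h
    · rw [ih (BohmTree.lam_injective h)]
    · exact absurd h BohmTree.lam_ne_app
  | app h args =>
    rintro (ν' | ⟨h', args'⟩) h
    · exact absurd h.symm BohmTree.lam_ne_app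
    · obtain ⟨rfl, rfl⟩ := BohmTree.app_inj h
      rfl

theorem Node.toTree_surjective {n : ℕ} :
    Function.Surjective (Node.toTree (V := V) (C := C) (n := n)) := by
  intro M
  induction M using BohmTree.induction_lam with
  | app n h args => exact ⟨.app h args, rfl⟩
  | lam n M ih =>
    obtain ⟨ν, rfl⟩ := ih
    exact ⟨.lam ν, rfl⟩

theorem encSpine_injective {n : ℕ} : Function.Injective (encSpine (V := V) (C := C) (n := n)) := by
  intro L
  induction L with
  | nil =>
    rintro (_ | ⟨M', L'⟩) h
    · rfl
    · simpa using (ITm.con_inj h).1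
  | cons M L ih =>
    rintro (_ | ⟨M', L'⟩) h
    · simpa using (ITm.con_inj h).1
    · have := (ITm.con_inj h).2
      simp only [List.cons.injEq, and_true] at this
      rw [this.1, ih this.2]

theorem encApp_inj {n : ℕ} {h h' : BHead V C n} {S S' : ITm (Con4 V C) n}
    (e : encApp h S = encApp h' S') : h = h' ∧ S = S' := by
  have e₁ := (List.cons.inj (ITm.con_inj e).2).1
  -- A bound and a named variable both go under `varntm`; only the first argument separates them. A
  -- constant is separated by `constntm`.
  cases h <;> cases h' <;> have e₂ := ITm.con_inj e₁ <;>
    simp only [reduceCtorEq, List.cons.injEq, and_true, true_and, false_and] at e₂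
  · exact ⟨congrArg _ (ITm.var_inj e₂.1).1, e₂.2⟩
  · exact absurd e₂.1 ITm.var_ne_con
  · exact absurd e₂.1.symm ITm.var_ne_con
  · refine ⟨congrArg _ ?_, e₂.2⟩
    simpa using (ITm.con_inj e₂.1).1
  · refine ⟨congrArg _ ?_, e₂.2⟩
    simpa using (ITm.con_inj e₂.1).1

theorem Node.encode_injective {n : ℕ} :
    Function.Injective (Node.encode (V := V) (C := C) (n := n)) := by
  intro ν
  induction ν with
  | lam ν ih =>
    rintro (ν' | ⟨h', args'⟩) h
    · rw [ih (ITm.lam_injective (List.cons.inj (ITm.con_inj h).2).1)]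
    · simpa using (ITm.con_inj h).1
  | app h args =>
    rintro (ν' | ⟨h', args'⟩) h
    · simpa using (ITm.con_inj h).1
    · obtain ⟨rfl, h₂⟩ := encApp_inj h
      rw [encSpine_injective h₂]

end Node

/-! ## Corecursion -/

section Unfold

variable {V : Type u} {C : Type v} {X : ℕ → Type w}

theorem ITm.obs_eq_of_succ {κ : Type u} {n k : ℕ} {M N : ITm κ n}
    (h : M.obs (k + 1) = N.obs (k + 1)) : M.obs k = N.obs k := by
  rw [← M.coherent, ← N.coherent, h]

theorem ITm.lam_obs_congr {κ : Type u} {n k : ℕ} {M N : ITm κ (n + 1)} (h : M.obs k = N.obs k) :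
    (ITm.lam M).obs k = (ITm.lam N).obs k := by
  cases k with
  | zero => rfl
  | succ k => exact congrArg _ h

theorem ITm.con_obs_congr {κ : Type u} {n k : ℕ} {c : κ} {L L' : List (ITm κ n)}
    (h : L.map (fun N => N.obs k) = L'.map fun N => N.obs k) :
    (ITm.con c L).obs (k + 1) = (ITm.con c L').obs (k + 1) :=
  congrArg (fun L => Tm.con c (Sp.ofList L)) h

theorem encSpine_obs_congr {n k : ℕ} {f g : X n → ITm (Con4 V C) n}
    (h : ∀ x, (f x).obs k = (g x).obs k) (L : List (X n)) :
    (encSpine (L.map f)).obs (k + 1) = (encSpine (L.map g)).obs (k + 1) := by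
  induction L with
  | nil => rfl
  | cons x L ih =>
    refine ITm.con_obs_congr ?_
    simp [h x, ITm.obs_eq_of_succ ih]

/-- The two constants around the spine gain further depth, which is not needed: `encSpine_obs_congr`
already supplies the one step required for guardedness. -/
theorem encApp_obs_congr {n k : ℕ} (h : BHead V C n) {S S' : ITm (Con4 V C) n}
    (hS : S.obs k = S'.obs k) : (encApp h S).obs k = (encApp h S').obs k := by
  obtain _ | _ | k := k
  · rfl
  · refine ITm.con_obs_congr ?_
    simp [ITm.obs_zero]
  · have := ITm.obs_eq_of_succ (ITm.obs_eq_of_succ hS)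
    have := ITm.obs_eq_of_succ hS
    cases h <;>
    · refine ITm.con_obs_congr ?_
      simp only [List.map_cons, List.map_nil, List.cons.injEq, and_true]
      refine ITm.con_obs_congr ?_
      simp [*]

/-- This is the guardedness of the encoding, which makes corecursion converge and its solutions
unique. -/
theorem Node.encode_obs_congr {f g : ∀ n, X n → ITm (Con4 V C) n} {k : ℕ}
    (h : ∀ n x, (f n x).obs k = (g n x).obs k) {n : ℕ} (ν : Node V C X n) :
    (ν.map f).encode.obs (k + 1) = (ν.map g).encode.obs (k + 1) := by
  induction ν with
  | lam ν ih =>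
    refine ITm.con_obs_congr ?_
    simp [ITm.lam_obs_congr (ITm.obs_eq_of_succ ih)]
  | app hd args => exact encApp_obs_congr _ (encSpine_obs_congr (h _) args)

theorem Node.toTree_obs_congr {f g : ∀ n, X n → BohmTree V C n} {k : ℕ}
    (h : ∀ n x, (f n x).obs k = (g n x).obs k) {n : ℕ} (ν : Node V C X n) :
    (ν.map f).toTree.obs (k + 1) = (ν.map g).toTree.obs (k + 1) := by
  induction ν with
  | lam ν ih => exact congrArg BT.lam ih
  | app hd args =>
    refine congrArg (fun L => BT.app hd (BSp.ofList L)) ?_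
    simp [h]

variable (c : ∀ n, X n → Node V C X n)

/-- The terms that approximate the encoding of the trees described by `c`. -/
def encodeIter : ℕ → ∀ n, X n → ITm (Con4 V C) n
  -- Any term would do, as depth 0 shows nothing; this one exists whatever `V`, `C` and `n` are.
  | 0, _, _ => .con .snil []
  | k + 1, n, x => ((c n x).map (encodeIter k)).encode

theorem encodeIter_succ_obs (k : ℕ) : ∀ n x,
    (encodeIter c (k + 1) n x).obs k = (encodeIter c k n x).obs k := by
  induction k with
  | zero => intro n x; simp [ITm.obs_zero]
  | succ k ih => exact fun n x => Node.encode_obs_congr ih (c n x)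

/-- The encoding of the trees described by the coalgebra `c`. -/
def encodeUnfold (n : ℕ) (x : X n) : ITm (Con4 V C) n where
  -- Diagonal limit: from the `k`-th iterate on, the observation of depth `k` is stable.
  obs k := (encodeIter c k n x).obs k
  coherent k := by rw [ITm.coherent, encodeIter_succ_obs]

theorem encodeUnfold_eq (n : ℕ) (x : X n) :
    encodeUnfold c n x = ((c n x).map (encodeUnfold c)).encode :=
  ITm.ext_succ fun k =>
    Node.encode_obs_congr (f := encodeIter c k) (g := encodeUnfold c) (fun _ _ => rfl) (c n x)

/-- The encoding of the trees described by a coalgebra is unique. -/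
theorem encode_unique {f g : ∀ n, X n → ITm (Con4 V C) n}
    (hf : ∀ n x, f n x = ((c n x).map f).encode) (hg : ∀ n x, g n x = ((c n x).map g).encode)
    (n : ℕ) (x : X n) : f n x = g n x := by
  ext k
  induction k generalizing n with
  | zero => simp [ITm.obs_zero]
  | succ k ih => rw [hf, hg, Node.encode_obs_congr ih]

/-- Trees that approximate the trees described by `c`. -/
def treeIter : ℕ → ∀ n, X n → BohmTree V C n
  -- The identity tree is an arbitrary start that exists even when `V` and `C` are empty and `n =
  -- 0`.
  | 0, _, _ => .lam (.app (.var 0) [])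
  | k + 1, n, x => ((c n x).map (treeIter k)).toTree

theorem treeIter_succ_obs (k : ℕ) : ∀ n x,
    (treeIter c (k + 1) n x).obs k = (treeIter c k n x).obs k := by
  induction k with
  | zero => intro n x; simp [BohmTree.obs_zero]
  | succ k ih => exact fun n x => Node.toTree_obs_congr ih (c n x)

/-- The trees described by the coalgebra `c`. -/
def treeUnfold (n : ℕ) (x : X n) : BohmTree V C n where
  obs k := (treeIter c k n x).obs k
  coherent k := by rw [BohmTree.coherent, treeIter_succ_obs]

theorem treeUnfold_eq (n : ℕ) (x : X n) :
    treeUnfold c n x = ((c n x).map (treeUnfold c)).toTree :=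
  BohmTree.ext_succ fun k =>
    Node.toTree_obs_congr (f := treeIter c k) (g := treeUnfold c) (fun _ _ => rfl) (c n x)

/-- The trees described by a coalgebra are unique. -/
theorem tree_unique {f g : ∀ n, X n → BohmTree V C n}
    (hf : ∀ n x, f n x = ((c n x).map f).toTree) (hg : ∀ n x, g n x = ((c n x).map g).toTree)
    (n : ℕ) (x : X n) : f n x = g n x := by
  ext k
  induction k generalizing n with
  | zero => simp [BohmTree.obs_zero]
  | succ k ih => rw [hf, hg, Node.toTree_obs_congr ih]

end Unfold

/-! ## Typing over non-dependent types -/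

/-- Non-dependent types over the type family names `F`. -/
inductive STy (F : Type v)
  | base : F → STy F
  | arr : STy F → STy F → STy F

namespace STy

variable {F : Type v} {κ : Type u}

def toITy : STy F → {n : ℕ} → ITy F κ n
  | .base a, _ => .base a
  | .arr B A, _ => .pi B.toITy A.toITy

def args : STy F → List (STy F)
  | .base _ => []
  | .arr B A => B :: A.args

def target : STy F → F
  | .base a => a
  | .arr _ A => A.target

theorem rename_obs (A : STy F) {n m k : ℕ} (ρ : Fin n → Fin m) :
    ((A.toITy : ITy F κ n).obs k).rename ρ = (A.toITy : ITy F κ m).obs k := by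
  induction A generalizing n m with
  | base a => cases k <;> simp [toITy, ITy.base, Ty.rename, Sp.rename]
  | arr B A ihB ihA => cases k <;> simp [toITy, ITy.pi, Ty.rename, ihA, ihB]

/-- All atoms carry empty spines, so substitution meets no term and merely changes the scope. -/
theorem hsubstTy_iff (A : STy F) {n k : ℕ} {τ : Simple} {i : Fin (n + 1)} {N : Tm κ k n}
    {A' : Ty F κ (k + 1) n} :
    HSubstTy τ i N ((A.toITy : ITy F κ (n + 1)).obs (k + 1)) A' ↔
      A' = (A.toITy : ITy F κ n).obs (k + 1) := by
  induction A generalizing n with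
  | base a =>
    constructor
    · intro h
      cases h with
      | atom h => cases h; rfl
    · rintro rfl
      exact .atom .nil
  | arr B A ihB ihA =>
    constructor
    · intro h
      cases h with
      | pi h₁ h₂ => rw [ihB.1 h₁, ihA.1 h₂]; rfl
    · rintro rfl
      exact .pi (ihB.2 rfl) (ihA.2 rfl)

variable {Sg : Signature F κ}

/-- Without dependency, checking a spine amounts to checking each entry against its argument type.
-/
theorem sspine_iff (A : STy F) {n k : ℕ} {Γ : Ctx F κ (k + 1) n} {L : List (Tm κ k n)}
    {P : Ty F κ (k + 1) n} :
    SSpine Sg Γ (Sp.ofList L) ((A.toITy : ITy F κ n).obs (k + 1)) P ↔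
      P = .atom A.target .nil ∧
        List.Forall₂ (fun M (B : STy F) => Check Sg Γ.trunc M (B.toITy.obs k)) L A.args := by
  induction A generalizing L with
  | base a =>
    constructor
    · intro h
      cases L with
      | nil => cases h; exact ⟨rfl, .nil⟩
      | cons M L => cases h
    · rintro ⟨rfl, h⟩
      cases h
      exact .nil
  | arr B A _ ihA =>
    constructor
    · intro h
      cases L with
      | nil => cases h
      | cons M L =>
        cases h with
        | cons h₁ h₂ h₃ =>
          rw [A.hsubstTy_iff] at h₂
          subst h₂
          rw [B.toITy.coherent] at h₁
          exact ⟨(ihA.1 h₃).1, .cons h₁ (ihA.1 h₃).2⟩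
    · rintro ⟨rfl, h⟩
      cases h with
      | cons h₁ h₂ =>
        exact .cons (B.toITy.coherent k ▸ h₁) (A.hsubstTy_iff.2 rfl) (ihA.2 ⟨rfl, h₂⟩)

end STy

section Check

variable {F : Type v} {κ : Type u} {Sg : Signature F κ} {n k : ℕ}

theorem check_con_iff {T : κ → STy F} (hT : ∀ c, Sg.type c = (T c).toITy)
    {Γ : Ctx F κ (k + 1) n} {c : κ} {args : List (ITm κ n)} {a : F} :
    Check Sg Γ ((ITm.con c args).obs (k + 1)) ((ITy.base a).obs (k + 1)) ↔
      a = (T c).target ∧ List.Forall₂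
        (fun (M : ITm κ n) (B : STy F) => Check Sg Γ.trunc (M.obs k) (B.toITy.obs k))
        args (T c).args := by
  have key : SSpine Sg Γ (Sp.ofList (args.map fun N => N.obs k))
      (Ty.ofClosed ((Sg.type c).obs (k + 1))) ((ITy.base a).obs (k + 1)) ↔ a = (T c).target ∧
      List.Forall₂ (fun (M : ITm κ n) (B : STy F) => Check Sg Γ.trunc (M.obs k) (B.toITy.obs k))
        args (T c).args := by
    rw [hT, Ty.ofClosed, STy.rename_obs, STy.sspine_iff, List.forall₂_map_left_iff]
    refine and_congr_left fun _ => ?_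
    simp [ITy.base]
  rw [← key]
  constructor
  · intro h
    cases h with
    | neutral h =>
      cases h with
      | con h => exact h
  · exact fun h => .neutral (.con h)

theorem not_check_lam_base {Γ : Ctx F κ (k + 1) n} {M : ITm κ (n + 1)} {a : F} :
    ¬ Check Sg Γ ((ITm.lam M).obs (k + 1)) ((ITy.base a).obs (k + 1)) := by
  intro h
  cases h with
  | neutral h => cases h

theorem check_lam_iff {Γ : Ctx F κ (k + 1) n} {M : ITm κ (n + 1)} {B : ITy F κ n}
    {A : ITy F κ (n + 1)} :
    Check Sg Γ ((ITm.lam M).obs (k + 1)) ((ITy.pi B A).obs (k + 1)) ↔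
      Check Sg (Γ.snoc (B.obs (k + 1))) (M.obs (k + 1)) (A.obs (k + 1)) := by
  constructor
  · intro h
    cases h with
    | lam h => exact h
  · exact fun h => .lam h

/-- Only abstractions have function types. -/
theorem exists_eq_lam_of_check_pi {Γ : Ctx F κ (k + 1) n} {M : ITm κ n} {B : ITy F κ n}
    {A : ITy F κ (n + 1)} (h : Check Sg Γ (M.obs (k + 1)) ((ITy.pi B A).obs (k + 1))) :
    ∃ M', M = .lam M' := by
  rcases M.cases with hM | ⟨x, args, rfl⟩ | ⟨c, args, rfl⟩
  · exact hM
  · cases h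
  · cases h

end Check

/-! ## Typing over the signature of Böhm trees -/

section Sigma4

variable {V : Type u} {C : Type v} {n k : ℕ}

def Con4.sty : Con4 V C → STy Fam4
  | .lam => .arr (.arr (.base .vars) (.base .ctm)) (.base .ctm)
  | .base => .arr (.base .ntm) (.base .ctm)
  | .varntm => .arr (.base .vars) (.arr (.base .spine) (.base .ntm))
  | .constntm => .arr (.base .consts) (.arr (.base .spine) (.base .ntm))
  | .snil => .base .spine
  | .scons => .arr (.base .ctm) (.arr (.base .spine) (.base .spine))
  | .free _ => .base .vars
  | .const _ => .base .consts

theorem Sigma4_type (c : Con4 V C) : (Sigma4 V C).type c = c.sty.toITy := by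
  cases c <;> rfl

theorem varsCtx_obs_trunc : ((varsCtx V C n).obs (k + 1)).trunc = (varsCtx V C n).obs k := by
  induction n with
  | zero => rfl
  | succ n ih =>
    simp only [varsCtx, ICtx.obs, Ctx.trunc, ih, ITy.coherent]

theorem varsCtx_lookup (x : Fin n) :
    ((varsCtx V C n).obs (k + 1)).lookup x = (ITy.base .vars).obs (k + 1) := by
  induction n with
  | zero => exact x.elim0
  | succ n ih =>
    have hw : ∀ n : ℕ, ((ITy.base Fam4.vars : ITy Fam4 (Con4 V C) n).obs (k + 1)).weaken =
      (ITy.base .vars).obs (k + 1) := fun n => (STy.base Fam4.vars).rename_obs _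
    refine Fin.cases ?_ (fun i => ?_) x
    · exact hw n
    · simp only [varsCtx, ICtx.obs, Ctx.lookup, Fin.cases_succ, ih, hw]

/-- The observation of depth `k` of `M` has type `A`. -/
def CheckAt (k : ℕ) (M : ITm (Con4 V C) n) (A : STy Fam4) : Prop :=
  Check (Sigma4 V C) ((varsCtx V C n).obs k) (M.obs k) (A.toITy.obs k)

theorem checkAt_zero {M : ITm (Con4 V C) n} {A : STy Fam4} : CheckAt 0 M A := by
  rw [CheckAt, M.obs_zero]
  exact .unobs

theorem checkAt_con_iff {c : Con4 V C} {args : List (ITm (Con4 V C) n)} {a : Fam4} :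
    CheckAt (k + 1) (.con c args) (.base a) ↔
      a = c.sty.target ∧ List.Forall₂ (CheckAt k) args c.sty.args := by
  have := check_con_iff (Sg := Sigma4 V C) Sigma4_type (Γ := (varsCtx V C n).obs (k + 1)) (c := c)
    (args := args) (a := a)
  rw [varsCtx_obs_trunc] at this
  exact this

/-- The extended context is again a `varsCtx`, and an abstraction costs no observation. -/
theorem checkAt_lam_iff {M : ITm (Con4 V C) (n + 1)} {A : STy Fam4} :
    CheckAt k (.lam M) (.arr (.base .vars) A) ↔ CheckAt k M A := by
  cases k with
  | zero => simp [checkAt_zero]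
  | succ k => exact check_lam_iff

theorem checkAt_var_iff {x : Fin n} {args : List (ITm (Con4 V C) n)} {a : Fam4} :
    CheckAt (k + 1) (.var x args) (.base a) ↔ a = .vars ∧ args = [] := by
  constructor
  · intro h
    cases h with
    | neutral h =>
      cases h with
      | var h =>
        rw [varsCtx_lookup] at h
        cases args with
        | nil => cases h; exact ⟨rfl, rfl⟩
        | cons M args => cases h
  · rintro ⟨rfl, rfl⟩
    refine .neutral (.var ?_)
    rw [varsCtx_lookup]
    exact .nil

/-- All observations of `M` have type `A`. -/
def Typed (M : ITm (Con4 V C) n) (A : STy Fam4) : Prop := ∀ k, CheckAt k M A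

/-- `Nonempty ι` is what forces the two lists to have equal length in the direction from left to
right. -/
theorem forall₂_forall_iff {ι α β : Type*} [Nonempty ι] {R : ι → α → β → Prop} {L : List α}
    {L' : List β} : (∀ i, List.Forall₂ (R i) L L') ↔ List.Forall₂ (fun a b => ∀ i, R i a b) L L' := by
  induction L generalizing L' with
  | nil => cases L' <;> simp
  | cons a L ih => cases L' <;> simp [← ih, forall_and]

theorem typed_con_iff {c : Con4 V C} {args : List (ITm (Con4 V C) n)} {a : Fam4} :
    Typed (.con c args) (.base a) ↔ a = c.sty.target ∧ List.Forall₂ Typed args c.sty.args := by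
  have : Typed (.con c args) (.base a) ↔ ∀ k, CheckAt (k + 1) (.con c args) (.base a) :=
    ⟨fun h k => h _, fun h k => by cases k with | zero => exact checkAt_zero | succ k => exact h k⟩
  rw [this]
  simp only [checkAt_con_iff, forall_and, forall_const, forall₂_forall_iff]
  rfl

theorem Typed.cases_base {M : ITm (Con4 V C) n} {a : Fam4} (h : Typed M (.base a)) :
    (∃ x, M = .var x [] ∧ a = .vars) ∨
      ∃ c args, M = .con c args ∧ a = c.sty.target ∧ List.Forall₂ Typed args c.sty.args := by
  rcases M.cases with ⟨M', rfl⟩ | ⟨x, args, rfl⟩ | ⟨c, args, rfl⟩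
  · exact absurd (h 1) not_check_lam_base
  · obtain ⟨rfl, rfl⟩ := checkAt_var_iff.1 (h 1)
    exact .inl ⟨x, rfl, rfl⟩
  · exact .inr ⟨c, args, rfl, typed_con_iff.1 h⟩

theorem Typed.exists_lam {M : ITm (Con4 V C) n} {A : STy Fam4}
    (h : Typed M (.arr (.base .vars) A)) : ∃ M', M = .lam M' ∧ Typed M' A := by
  obtain ⟨M', rfl⟩ := exists_eq_lam_of_check_pi (h 1)
  exact ⟨M', rfl, fun k => checkAt_lam_iff.1 (h k)⟩

theorem Typed.cases_ctm {M : ITm (Con4 V C) n} (h : Typed M (.base .ctm)) :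
    (∃ M', M = encLam M' ∧ Typed M' (.base .ctm)) ∨
      ∃ R, M = .con .base [R] ∧ Typed R (.base .ntm) := by
  obtain ⟨x, rfl, hx⟩ | ⟨c, args, rfl, hc, hargs⟩ := h.cases_base
  · cases hx
  -- Only `lam` and `base` have target family `ctm`.
  · cases c <;> first | cases hc; done | skip
    · simp only [Con4.sty, STy.args, List.forall₂_cons_right_iff, List.forall₂_nil_right_iff,
        exists_and_left, exists_eq_left] at hargs
      obtain ⟨N, hN, rfl⟩ := hargs
      obtain ⟨M', rfl, hM'⟩ := hN.exists_lam
      exact .inl ⟨M', rfl, hM'⟩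
    · simp only [Con4.sty, STy.args, List.forall₂_cons_right_iff, List.forall₂_nil_right_iff,
        exists_and_left, exists_eq_left] at hargs
      obtain ⟨N, hN, rfl⟩ := hargs
      exact .inr ⟨N, rfl, hN⟩

theorem Typed.cases_spine {M : ITm (Con4 V C) n} (h : Typed M (.base .spine)) :
    M = .con .snil [] ∨
      ∃ N S, M = .con .scons [N, S] ∧ Typed N (.base .ctm) ∧ Typed S (.base .spine) := by
  obtain ⟨x, rfl, hx⟩ | ⟨c, args, rfl, hc, hargs⟩ := h.cases_base
  · cases hx
  · cases c <;> first | cases hc; done | skip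
    · cases hargs
      exact .inl rfl
    · cases hargs with
      | cons h₁ hargs =>
        cases hargs with
        | cons h₂ hargs =>
          cases hargs
          exact .inr ⟨_, _, rfl, h₁, h₂⟩

/-- `varntm x S` or `constntm c S`. -/
def encNtm (h : BHead V C n) (S : ITm (Con4 V C) n) : ITm (Con4 V C) n :=
  match h with
  | .var x => .con .varntm [.var x [], S]
  | .free x => .con .varntm [.con (.free x) [], S]
  | .const c => .con .constntm [.con (.const c) [], S]

theorem encApp_eq (h : BHead V C n) (S : ITm (Con4 V C) n) :
    encApp h S = .con .base [encNtm h S] := by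
  cases h <;> rfl

/-- A term of type `vars` is a context variable or some `free x`, and one of type `consts` is some
`const c`; these are exactly the heads of Böhm trees. -/
theorem Typed.cases_ntm {M : ITm (Con4 V C) n} (h : Typed M (.base .ntm)) :
    ∃ hd S, M = encNtm hd S ∧ Typed S (.base .spine) := by
  obtain ⟨x, rfl, hx⟩ | ⟨c, args, rfl, hc, hargs⟩ := h.cases_base
  · cases hx
  · cases c <;> first | cases hc; done | skip
    · cases hargs with
      | cons h₁ hargs =>
        cases hargs with
        | cons h₂ hargs =>
          cases hargs
          obtain ⟨x, rfl, -⟩ | ⟨c, args, rfl, hc, hargs⟩ := h₁.cases_base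
          · exact ⟨.var x, _, rfl, h₂⟩
          · cases c <;> first | cases hc; done | skip
            cases hargs
            exact ⟨.free _, _, rfl, h₂⟩
    · cases hargs with
      | cons h₁ hargs =>
        cases hargs with
        | cons h₂ hargs =>
          cases hargs
          obtain ⟨x, rfl, hx⟩ | ⟨c, args, rfl, hc, hargs⟩ := h₁.cases_base
          · cases hx
          · cases c <;> first | cases hc; done | skip
            cases hargs
            exact ⟨.const _, _, rfl, h₂⟩

/-- Each `scons` lowers the depth by one, so the entries are met at different depths; hence the
hypothesis for every `j ≤ k`. -/
theorem checkAt_encSpine {X : Type*} {f : X → ITm (Con4 V C) n}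
    (hf : ∀ j ≤ k, ∀ x, CheckAt j (f x) (.base .ctm)) (L : List X) :
    ∀ j ≤ k + 1, CheckAt j (encSpine (L.map f)) (.base .spine) := by
  induction L with
  | nil =>
    rintro (_ | j) hj
    · exact checkAt_zero
    · exact checkAt_con_iff.2 ⟨rfl, .nil⟩
  | cons x L ih =>
    rintro (_ | j) hj
    · exact checkAt_zero
    · exact checkAt_con_iff.2 ⟨rfl, .cons (hf _ (by omega) x) (.cons (ih _ (by omega)) .nil)⟩

theorem checkAt_encNtm {S : ITm (Con4 V C) n} (hS : ∀ j ≤ k, CheckAt j S (.base .spine))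
    (h : BHead V C n) : ∀ j ≤ k + 1, CheckAt j (encNtm h S) (.base .ntm) := by
  rintro (_ | j) hj
  · exact checkAt_zero
  have hS' := hS j (by omega)
  cases h with
  | var x =>
    refine checkAt_con_iff.2 ⟨rfl, .cons ?_ (.cons hS' .nil)⟩
    cases j with
    | zero => exact checkAt_zero
    | succ j => exact checkAt_var_iff.2 ⟨rfl, rfl⟩
  | free x =>
    refine checkAt_con_iff.2 ⟨rfl, .cons ?_ (.cons hS' .nil)⟩
    cases j with
    | zero => exact checkAt_zero
    | succ j => exact checkAt_con_iff.2 ⟨rfl, .nil⟩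
  | const x =>
    refine checkAt_con_iff.2 ⟨rfl, .cons ?_ (.cons hS' .nil)⟩
    cases j with
    | zero => exact checkAt_zero
    | succ j => exact checkAt_con_iff.2 ⟨rfl, .nil⟩

theorem checkAt_encode {X : ℕ → Type w} {f : ∀ n, X n → ITm (Con4 V C) n}
    (hf : ∀ j ≤ k, ∀ n x, CheckAt j (f n x) (.base .ctm)) (ν : Node V C X n) :
    ∀ j ≤ k + 1, CheckAt j (ν.map f).encode (.base .ctm) := by
  induction ν with
  | lam ν ih =>
    rintro (_ | j) hj
    · exact checkAt_zero
    · exact checkAt_con_iff.2 ⟨rfl, .cons (checkAt_lam_iff.2 (ih j (by omega))) .nil⟩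
  | app h args =>
    rintro (_ | j) hj
    · exact checkAt_zero
    · rw [Node.map, Node.encode, encApp_eq]
      refine checkAt_con_iff.2 ⟨rfl, .cons ?_ .nil⟩
      exact checkAt_encNtm (checkAt_encSpine (fun j hj => hf j hj _) args) h j (by omega)

/-- The encoding of trees is well typed. -/
theorem typed_encode {X : ℕ → Type w} {c : ∀ n, X n → Node V C X n}
    {f : ∀ n, X n → ITm (Con4 V C) n} (hf : ∀ n x, f n x = ((c n x).map f).encode)
    (x : X n) : Typed (f n x) (.base .ctm) := by
  have : ∀ k, ∀ j ≤ k, ∀ n x, CheckAt j (f n x) (.base .ctm) := by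
    intro k
    induction k with
    | zero =>
      intro j hj n x
      obtain rfl : j = 0 := by omega
      exact checkAt_zero
    | succ k ih =>
      intro j hj n x
      rw [hf]
      exact checkAt_encode ih _ j hj
  exact fun k => this k k le_rfl n x

end Sigma4

/-! ## Traces -/

section Trace

variable {κ : Type u} {n : ℕ}

theorem traceStep_con_iff {c : κ} {args : List (ITm κ n)} {h : TraceHead κ} {s : Σ m, ITm κ m} :
    TraceStep ⟨n, .con c args⟩ h s ↔ h = .const c ∧ ∃ N ∈ args, s = ⟨n, N⟩ := by
  constructor
  · intro hs
    -- `ITm.con` is a function and not a constructor, so inversion must go through an equation,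
    -- refuted or decomposed by the lemmas on `ITm`.
    generalize he : (⟨n, .con c args⟩ : Σ m, ITm κ m) = r at hs
    cases hs with
    | var hN =>
      obtain ⟨rfl, he⟩ := Sigma.mk.inj he
      exact absurd (eq_of_heq he).symm ITm.var_ne_con
    | con hN =>
      obtain ⟨rfl, he⟩ := Sigma.mk.inj he
      obtain ⟨rfl, rfl⟩ := ITm.con_inj (eq_of_heq he)
      exact ⟨rfl, _, hN, rfl⟩
    | lam hs =>
      obtain ⟨rfl, he⟩ := Sigma.mk.inj he
      exact absurd (eq_of_heq he).symm ITm.lam_ne_con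
  · rintro ⟨rfl, N, hN, rfl⟩
    exact .con hN

theorem not_traceStep_var_nil {x : Fin n} {h : TraceHead κ} {s : Σ m, ITm κ m} :
    ¬ TraceStep ⟨n, .var x []⟩ h s := by
  intro hs
  generalize he : (⟨n, .var x []⟩ : Σ m, ITm κ m) = r at hs
  cases hs with
  | var hN =>
    obtain ⟨rfl, he⟩ := Sigma.mk.inj he
    obtain ⟨rfl, rfl⟩ := ITm.var_inj (eq_of_heq he)
    simp at hN
  | con hN =>
    obtain ⟨rfl, he⟩ := Sigma.mk.inj he
    exact ITm.var_ne_con (eq_of_heq he)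
  | lam hs =>
    obtain ⟨rfl, he⟩ := Sigma.mk.inj he
    exact ITm.lam_ne_var (eq_of_heq he).symm

theorem traceStep_lam_iff {M : ITm κ (n + 1)} {h : TraceHead κ} {s : Σ m, ITm κ m} :
    TraceStep ⟨n, .lam M⟩ h s ↔ TraceStep ⟨n + 1, M⟩ h s := by
  constructor
  · intro hs
    generalize he : (⟨n, .lam M⟩ : Σ m, ITm κ m) = r at hs
    cases hs with
    | var hN =>
      obtain ⟨rfl, he⟩ := Sigma.mk.inj he
      exact absurd (eq_of_heq he) ITm.lam_ne_var
    | con hN =>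
      obtain ⟨rfl, he⟩ := Sigma.mk.inj he
      exact absurd (eq_of_heq he) ITm.lam_ne_con
    | lam hs =>
      obtain ⟨rfl, he⟩ := Sigma.mk.inj he
      cases ITm.lam_injective (eq_of_heq he)
      exact hs
  · exact .lam

variable {F : Type v} {Sg : Signature F κ}

/-- Validity passes to arguments. -/
theorem TraceValid.of_step {m : ℕ} {M : ITm κ n} {N : ITm κ m} {h : TraceHead κ}
    (hM : TraceValid Sg M) (hs : TraceStep ⟨n, M⟩ h ⟨m, N⟩) : TraceValid Sg N := by
  rintro t ⟨f, hf₀, hf⟩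
  -- Prefixing one head to a trace does not change what occurs infinitely often.
  let t' : ℕ → TraceHead κ := fun | 0 => h | i + 1 => t i
  have ht' : ∀ c, OccursInfinitelyOften t' c ↔ OccursInfinitelyOften t c := by
    intro c
    simp only [OccursInfinitelyOften, Filter.frequently_atTop]
    constructor
    · intro H a
      obtain ⟨b, hb, hc⟩ := H (a + 1)
      obtain ⟨b, rfl⟩ : ∃ b', b = b' + 1 := ⟨b - 1, by omega⟩
      exact ⟨b, by omega, hc⟩
    · intro H a
      obtain ⟨b, hb, hc⟩ := H a
      exact ⟨b + 1, by omega, hc⟩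
  obtain ⟨c, a, h₁, h₂, h₃, h₄⟩ := hM t' ⟨fun | 0 => ⟨n, M⟩ | i + 1 => f i, rfl, by
    rintro (_ | i)
    · simpa [t', hf₀] using hs
    · exact hf i⟩
  exact ⟨c, a, h₁, h₂, (ht' c).1 h₃, fun c' a' hc' ho => h₄ c' a' hc' ((ht' c').2 ho)⟩

/-- Validity passes to the bodies of abstractions. -/
theorem TraceValid.of_lam {M : ITm κ (n + 1)} (hM : TraceValid Sg (.lam M)) :
    TraceValid Sg M := by
  rintro t ⟨f, hf₀, hf⟩
  -- Abstractions leave no entry in a trace, so the same `t` serves with only the starting term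
  -- replaced.
  refine hM t ⟨fun | 0 => ⟨n, .lam M⟩ | i + 1 => f (i + 1), rfl, ?_⟩
  rintro (_ | i)
  · exact .lam (hf₀ ▸ hf 0)
  · exact hf (i + 1)

/-- A term with an infinite trace along a single inductive constructor is not valid. -/
theorem not_traceValid_of_const {c : κ} (hc : ∀ a, Sg.Constructs c a → ¬ Sg.Coinductive a)
    {P : (Σ m, ITm κ m) → Prop} (hP : ∀ s, P s → ∃ s', P s' ∧ TraceStep s (.const c) s')
    {M : ITm κ n} (hM : P ⟨n, M⟩) : ¬ TraceValid Sg M := by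
  intro hv
  choose next hnext using hP
  let f : ℕ → {s // P s} := fun i =>
    Nat.rec ⟨⟨n, M⟩, hM⟩ (fun _ s => ⟨next s.1 s.2, (hnext s.1 s.2).1⟩) i
  obtain ⟨c', a, h₁, h₂, h₃, -⟩ := hv (fun _ => .const c)
    ⟨fun i => (f i).1, rfl, fun i => (hnext (f i).1 (f i).2).2⟩
  obtain ⟨i, hi⟩ := h₃.exists
  cases hi
  exact hc a h₁ h₂

end Trace

-- Validity over the signature of Böhm trees

section Sigma4

variable {V : Type u} {C : Type v} {n : ℕ}

theorem Sigma4_constructs_iff {c : Con4 V C} {a : Fam4} :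
    (Sigma4 V C).Constructs c a ↔ c.sty.target = a := by
  cases c <;> exact Iff.rfl

theorem Sigma4_coinductive_iff {a : Fam4} : (Sigma4 V C).Coinductive a ↔ a = .ntm := by
  cases a <;> simp [Signature.Coinductive, Sigma4, IKd.type, IKd.cotype, Kd.IsCo]

/-! ### Encodings of trees are valid -/

/-- The term has a base type, or a function type from `vars` to a base type. -/
def FirstOrder (s : Σ m, ITm (Con4 V C) m) : Prop :=
  ∃ a, Typed s.2 (.base a) ∨ Typed s.2 (.arr (.base .vars) (.base a))

theorem FirstOrder.of_mem {c : Con4 V C} {args : List (ITm (Con4 V C) n)}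
    (h : List.Forall₂ Typed args c.sty.args) {N : ITm (Con4 V C) n} (hN : N ∈ args) :
    FirstOrder ⟨n, N⟩ := by
  have hB : ∀ B ∈ c.sty.args, ∃ a, B = .base a ∨ B = .arr (.base .vars) (.base a) := by
    cases c <;> simp [Con4.sty, STy.args]
  obtain ⟨i, hi, rfl⟩ := List.getElem_of_mem hN
  have hi' : i < c.sty.args.length := h.length_eq ▸ hi
  have ht : Typed args[i] c.sty.args[i] := h.get hi hi'
  obtain ⟨a, ha | ha⟩ := hB _ (List.getElem_mem hi')
  · exact ⟨a, .inl (ha ▸ ht)⟩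
  · exact ⟨a, .inr (ha ▸ ht)⟩

/-- The second conclusion keeps constructors without arguments off infinite traces, in particular
those of `vars` and `consts`, which outrank `ntm`. -/
theorem Typed.step_base {M : ITm (Con4 V C) n} {a : Fam4} (hM : Typed M (.base a))
    {h : TraceHead (Con4 V C)} {s : Σ m, ITm (Con4 V C) m} (hs : TraceStep ⟨n, M⟩ h s) :
    FirstOrder s ∧ ∀ c, h = .const c → c.sty.args ≠ [] := by
  obtain ⟨x, rfl, -⟩ | ⟨c, args, rfl, -, hargs⟩ := hM.cases_base
  · exact absurd hs not_traceStep_var_nil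
  · obtain ⟨rfl, N, hN, rfl⟩ := traceStep_con_iff.1 hs
    refine ⟨.of_mem hargs hN, ?_⟩
    rintro c' hc' h'
    cases hc'
    rw [h'] at hargs
    cases hargs
    simp at hN

theorem FirstOrder.step {s s' : Σ m, ITm (Con4 V C) m} {h : TraceHead (Con4 V C)}
    (hM : FirstOrder s) (hs : TraceStep s h s') :
    FirstOrder s' ∧ ∀ c, h = .const c → c.sty.args ≠ [] := by
  obtain ⟨m, M⟩ := s
  obtain ⟨a, hM | hM⟩ := hM
  · exact hM.step_base hs
  · have hM : Typed M (.arr (.base .vars) (.base a)) := hM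
    obtain ⟨M', rfl, ht⟩ := hM.exists_lam
    exact ht.step_base (traceStep_lam_iff.1 hs)

/-- A trace of a well-typed term that passes through `varntm` or `constntm` infinitely often
satisfies the validity condition. -/
theorem traceValid_of_ntm {M : ITm (Con4 V C) n} {a : Fam4} (hM : Typed M (.base a))
    (h : ∀ (f : ℕ → Σ m, ITm (Con4 V C) m) (t : ℕ → TraceHead (Con4 V C)), f 0 = ⟨n, M⟩ →
      (∀ i, TraceStep (f i) (t i) (f (i + 1))) →
      ∀ i, ∃ j ≥ i, t j = .const .varntm ∨ t j = .const .constntm) :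
    TraceValid (Sigma4 V C) M := by
  rintro t ⟨f, hf₀, hf⟩
  have hfo : ∀ i, FirstOrder (f i) := by
    intro i
    induction i with
    | zero => rw [hf₀]; exact ⟨a, .inl hM⟩
    | succ i ih => exact (ih.step (hf i)).1
  have hmax : ∀ (c' : Con4 V C) (a' : Fam4), (Sigma4 V C).Constructs c' a' →
      OccursInfinitelyOften t c' → (Sigma4 V C).priority a' ≤ (Sigma4 V C).priority .ntm := by
    intro c' a' hc' ho
    obtain ⟨i, hi⟩ := ho.exists
    have := ((hfo i).step (hf i)).2 c' hi
    rw [Sigma4_constructs_iff] at hc'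
    subst hc'
    cases c' <;> simp [Con4.sty, STy.args, STy.target, Sigma4] at this ⊢
  have hfr : ∃ᶠ i in Filter.atTop, t i = .const .varntm ∨ t i = .const .constntm :=
    Filter.frequently_atTop.2 (h f t hf₀ hf)
  -- One of the two constructors of `ntm` must itself recur infinitely often.
  rcases Filter.frequently_or_distrib.1 hfr with hfr | hfr
  · exact ⟨.varntm, .ntm, Sigma4_constructs_iff.2 rfl, Sigma4_coinductive_iff.2 rfl, hfr, hmax⟩
  · exact ⟨.constntm, .ntm, Sigma4_constructs_iff.2 rfl, Sigma4_coinductive_iff.2 rfl, hfr, hmax⟩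

/-- The second step rules out descending into the head, which has no arguments, so the trace is in
the spine. -/
theorem encNtm_step {h : BHead V C n} {S : ITm (Con4 V C) n}
    {t t' : TraceHead (Con4 V C)} {s s' : Σ m, ITm (Con4 V C) m}
    (h₁ : TraceStep ⟨n, encNtm h S⟩ t s) (h₂ : TraceStep s t' s') :
    (t = .const .varntm ∨ t = .const .constntm) ∧ s = ⟨n, S⟩ := by
  cases h <;> obtain ⟨rfl, N, hN, rfl⟩ := traceStep_con_iff.1 h₁ <;>
    simp only [List.mem_cons, List.not_mem_nil, or_false] at hN <;>
    obtain rfl | rfl := hN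
  · exact absurd h₂ not_traceStep_var_nil
  · exact ⟨.inl rfl, rfl⟩
  · simp [traceStep_con_iff] at h₂
  · exact ⟨.inl rfl, rfl⟩
  · simp [traceStep_con_iff] at h₂
  · exact ⟨.inr rfl, rfl⟩

variable {X : ℕ → Type w} {g : ∀ n, X n → ITm (Con4 V C) n}
  {f : ℕ → Σ m, ITm (Con4 V C) m} {t : ℕ → TraceHead (Con4 V C)}

/-- Each trace through an encoded node reaches the spine of the node. -/
theorem Node.exists_ntm_of_step (hf : ∀ i, TraceStep (f i) (t i) (f (i + 1)))
    (ν : Node V C X n) : ∀ i, TraceStep ⟨n, (ν.map g).encode⟩ (t i) (f (i + 1)) →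
      ∃ j ≥ i, (t j = .const .varntm ∨ t j = .const .constntm) ∧
        ∃ m, ∃ L : List (X m), f (j + 1) = ⟨m, encSpine (L.map (g m))⟩ := by
  induction ν with
  | @lam n ν ih =>
    intro i hi
    obtain ⟨-, N, hN, hs⟩ := traceStep_con_iff.1 hi
    rw [List.mem_singleton] at hN
    subst hN
    -- Here `f (i + 1)` is the abstraction and not its body, which is why the induction speaks of
    -- the step taken rather than of the term `f i`.
    have hi' := hf (i + 1)
    rw [hs, traceStep_lam_iff] at hi'
    obtain ⟨j, hj, h⟩ := ih (i + 1) hi'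
    exact ⟨j, by omega, h⟩
  | @app n h args =>
    intro i hi
    rw [Node.map, Node.encode, encApp_eq] at hi
    obtain ⟨-, N, hN, hs⟩ := traceStep_con_iff.1 hi
    rw [List.mem_singleton] at hN
    subst hN
    have hi' := hf (i + 1)
    rw [hs] at hi'
    obtain ⟨ht, hS⟩ := encNtm_step hi' (hf (i + 1 + 1))
    exact ⟨i + 1, by omega, ht, n, args, hS⟩

/-- The spine is finite and `snil` has no successor, so the trace must turn into some entry, which
is again an encoded node. -/
theorem encSpine_exists_ntm {c : ∀ n, X n → Node V C X n}
    (hg : ∀ n x, g n x = ((c n x).map g).encode)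
    (hf : ∀ i, TraceStep (f i) (t i) (f (i + 1))) (L : List (X n)) :
    ∀ i, f i = ⟨n, encSpine (L.map (g n))⟩ →
      ∃ j ≥ i, (t j = .const .varntm ∨ t j = .const .constntm) ∧
        ∃ m, ∃ L : List (X m), f (j + 1) = ⟨m, encSpine (L.map (g m))⟩ := by
  induction L with
  | nil =>
    intro i hi
    have h := hf i
    rw [hi] at h
    simpa using (traceStep_con_iff.1 h).2
  | cons x L ih =>
    intro i hi
    have h := hf i
    rw [hi] at h
    obtain ⟨-, N, hN, hs⟩ := traceStep_con_iff.1 h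
    simp only [List.mem_cons, List.not_mem_nil, or_false] at hN
    have h' := hf (i + 1)
    obtain rfl | rfl := hN
    · rw [hs, hg] at h'
      obtain ⟨j, hj, hh⟩ := (c n x).exists_ntm_of_step hf (i + 1) h'
      exact ⟨j, by omega, hh⟩
    · obtain ⟨j, hj, hh⟩ := ih (i + 1) hs
      exact ⟨j, by omega, hh⟩

/-- The encoding of trees is valid. -/
theorem traceValid_encode {c : ∀ n, X n → Node V C X n}
    (hg : ∀ n x, g n x = ((c n x).map g).encode) (x : X n) :
    TraceValid (Sigma4 V C) (g n x) := by
  refine traceValid_of_ntm (typed_encode hg x) fun f t hf₀ hf => ?_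
  -- Recording that the trace then stands at an encoded spine allows the search to be restarted from
  -- there.
  have key : ∀ i, ∃ j ≥ i, (t j = .const .varntm ∨ t j = .const .constntm) ∧
        ∃ m, ∃ L : List (X m), f (j + 1) = ⟨m, encSpine (L.map (g m))⟩ := by
    intro i
    induction i with
    | zero =>
      have h := hf 0
      rw [hf₀, hg] at h
      exact (c n x).exists_ntm_of_step hf 0 h
    | succ i ih =>
      obtain ⟨j, hj, ht, m, L, hL⟩ := ih
      rcases Nat.eq_or_lt_of_le hj with rfl | hj
      · exact encSpine_exists_ntm hg hf L _ hL
      · exact ⟨j, hj, ht, m, L, hL⟩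
  intro i
  obtain ⟨j, hj, ht, -⟩ := key i
  exact ⟨j, hj, ht⟩

/-! ### Canonical terms are encodings of nodes -/

/-- If a typed spine were not a finite list, neither would its tail be; following the tails gives a
trace of `scons` alone, contradicting validity. -/
theorem exists_encSpine {S : ITm (Con4 V C) n} (hS : Typed S (.base .spine))
    (hv : TraceValid (Sigma4 V C) S) :
    ∃ L : List (CtmTerm V C n), S = encSpine (L.map Subtype.val) := by
  by_contra hL
  refine not_traceValid_of_const (c := Con4.scons)
    (P := fun s => Typed s.2 (.base .spine) ∧ TraceValid (Sigma4 V C) s.2 ∧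
      ¬ ∃ L : List (CtmTerm V C s.1), s.2 = encSpine (L.map Subtype.val)) ?_ ?_ ⟨hS, hv, hL⟩ hv
  · intro a ha
    rw [Sigma4_constructs_iff] at ha
    subst ha
    simp [Sigma4_coinductive_iff, Con4.sty, STy.target]
  · rintro ⟨m, S⟩ ⟨hS, hv, hL⟩
    dsimp only at hS hv hL
    obtain rfl | ⟨N, S', rfl, hN, hS'⟩ := hS.cases_spine
    · exact absurd ⟨[], rfl⟩ hL
    · have h₁ : TraceStep ⟨m, .con (.scons : Con4 V C) [N, S']⟩ (.const .scons) ⟨m, N⟩ :=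
        .con (by simp)
      have h₂ : TraceStep ⟨m, .con (.scons : Con4 V C) [N, S']⟩ (.const .scons) ⟨m, S'⟩ :=
        .con (by simp)
      refine ⟨⟨m, S'⟩, ⟨hS', hv.of_step h₂, ?_⟩, h₂⟩
      rintro ⟨L, hS'⟩
      exact hL ⟨⟨N, hN, hv.of_step h₁⟩ :: L, congrArg (fun S => ITm.con .scons [N, S]) hS'⟩

theorem exists_node_or_lam {M : ITm (Con4 V C) n} (hM : Typed M (.base .ctm))
    (hv : TraceValid (Sigma4 V C) M) :
    (∃ ν : Node V C (CtmTerm V C) n, M = (ν.map fun _ => Subtype.val).encode) ∨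
      ∃ M', M = encLam M' ∧ Typed M' (.base .ctm) ∧ TraceValid (Sigma4 V C) M' := by
  obtain ⟨M', rfl, hM'⟩ | ⟨R, rfl, hR⟩ := hM.cases_ctm
  · exact .inr ⟨M', rfl, hM', (hv.of_step (N := .lam M') (.con (by simp))).of_lam⟩
  · obtain ⟨h, S, rfl, hS⟩ := hR.cases_ntm
    have hv₁ : TraceValid (Sigma4 V C) (encNtm h S) := hv.of_step (.con (by simp))
    have hv₂ : TraceValid (Sigma4 V C) S := by
      cases h <;> exact hv₁.of_step (.con (by simp))
    obtain ⟨L, rfl⟩ := exists_encSpine hS hv₂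
    exact .inl ⟨.app h L, (encApp_eq _ _).symm⟩

/-- If no node encodes the term, it is a `lam` whose body is not encoded by a node either; the
resulting endless trace of `lam` contradicts validity. -/
theorem exists_node {M : ITm (Con4 V C) n} (hM : Typed M (.base .ctm))
    (hv : TraceValid (Sigma4 V C) M) :
    ∃ ν : Node V C (CtmTerm V C) n, M = (ν.map fun _ => Subtype.val).encode := by
  by_contra hν
  have key : ∀ {n : ℕ} {M : ITm (Con4 V C) n}, Typed M (.base .ctm) →
      TraceValid (Sigma4 V C) M →
      (¬ ∃ ν : Node V C (CtmTerm V C) n, M = (ν.map fun _ => Subtype.val).encode) →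
      ∃ M', M = encLam M' ∧ Typed M' (.base .ctm) ∧ TraceValid (Sigma4 V C) M' ∧
        ¬ ∃ ν : Node V C (CtmTerm V C) (n + 1), M' = (ν.map fun _ => Subtype.val).encode := by
    intro n M hM hv hν
    obtain ⟨M', rfl, hM', hv'⟩ := (exists_node_or_lam hM hv).resolve_left hν
    refine ⟨M', rfl, hM', hv', ?_⟩
    rintro ⟨ν, rfl⟩
    exact hν ⟨.lam ν, rfl⟩
  obtain ⟨M', rfl, hM', hv', hν'⟩ := key hM hv hν
  have hl : TraceValid (Sigma4 V C) (.lam M') := hv.of_step (.con (by simp))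
  -- The argument of `lam` is an abstraction, so the invariant describes `.lam M`, the form in which
  -- the trace visits these terms.
  refine not_traceValid_of_const (c := Con4.lam)
    (P := fun s => ∃ n, ∃ M : ITm (Con4 V C) (n + 1), s = ⟨n, .lam M⟩ ∧ Typed M (.base .ctm) ∧
      TraceValid (Sigma4 V C) M ∧
      ¬ ∃ ν : Node V C (CtmTerm V C) (n + 1), M = (ν.map fun _ => Subtype.val).encode)
    ?_ ?_ ⟨_, _, rfl, hM', hv', hν'⟩ hl
  · intro a ha
    rw [Sigma4_constructs_iff] at ha
    subst ha
    simp [Sigma4_coinductive_iff, Con4.sty, STy.target]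
  · rintro _ ⟨n, M, rfl, hM, hv, hν⟩
    obtain ⟨M', rfl, hM', hv', hν'⟩ := key hM hv hν
    exact ⟨⟨n + 1, .lam M'⟩, ⟨_, _, rfl, hM', hv', hν'⟩, .lam (.con (by simp))⟩

end Sigma4

/-! ## The encoding -/

section Encoding

variable (V : Type u) (C : Type v)

/-- The root node of a tree. -/
noncomputable def BohmTree.node (n : ℕ) (M : BohmTree V C n) : Node V C (BohmTree V C) n :=
  (Node.toTree_surjective M).choose

/-- The root node of a canonical term. -/
noncomputable def CtmTerm.node (n : ℕ) (M : CtmTerm V C n) : Node V C (CtmTerm V C) n :=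
  (exists_node M.2.1 M.2.2).choose

/-- The encoding of trees as canonical terms. -/
noncomputable def encode (n : ℕ) (M : BohmTree V C n) : CtmTerm V C n :=
  ⟨encodeUnfold (BohmTree.node V C) n M,
    typed_encode (encodeUnfold_eq _) M, traceValid_encode (encodeUnfold_eq _) M⟩

/-- The decoding of canonical terms as trees. -/
noncomputable def decode (n : ℕ) (M : CtmTerm V C n) : BohmTree V C n :=
  treeUnfold (CtmTerm.node V C) n M

variable {V C} {n : ℕ}

theorem BohmTree.toTree_node (M : BohmTree V C n) : (BohmTree.node V C n M).toTree = M :=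
  (Node.toTree_surjective M).choose_spec

theorem CtmTerm.encode_node (M : CtmTerm V C n) :
    M.val = ((CtmTerm.node V C n M).map fun _ => Subtype.val).encode :=
  (exists_node M.2.1 M.2.2).choose_spec

theorem encode_val (M : BohmTree V C n) :
    (encode V C n M).val = ((BohmTree.node V C n M).map fun n M => (encode V C n M).val).encode :=
  encodeUnfold_eq _ n M

theorem encode_toTree (ν : Node V C (BohmTree V C) n) :
    (encode V C n ν.toTree).val = (ν.map fun n M => (encode V C n M).val).encode := by
  rw [encode_val, Node.toTree_injective (BohmTree.toTree_node ν.toTree)]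

theorem decode_eq (M : CtmTerm V C n) :
    decode V C n M = ((CtmTerm.node V C n M).map (decode V C)).toTree :=
  treeUnfold_eq _ n M

/-- Encoding after decoding and the inclusion of canonical terms both solve the encoding equation of
the coalgebra `CtmTerm.node`. -/
theorem encode_decode (M : CtmTerm V C n) : encode V C n (decode V C n M) = M := by
  refine Subtype.ext ?_
  refine encode_unique (CtmTerm.node V C) (f := fun n M => (encode V C n (decode V C n M)).val)
    (g := fun _ => Subtype.val) (fun n M => ?_) (fun n M => M.encode_node) n M
  rw [decode_eq, encode_toTree, Node.map_map]

/-- Nodes are obtained by choice, but `Node.encode` is injective, so a term determines its node. -/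
theorem CtmTerm.node_encode (M : BohmTree V C n) :
    CtmTerm.node V C n (encode V C n M) = (BohmTree.node V C n M).map (encode V C) := by
  refine Node.map_injective (fun _ => Subtype.val_injective) (Node.encode_injective ?_)
  rw [← CtmTerm.encode_node, encode_val]
  exact congrArg _ (Node.map_map _ _ _).symm

theorem decode_encode (M : BohmTree V C n) : decode V C n (encode V C n M) = M := by
  refine tree_unique (BohmTree.node V C) (f := fun n M => decode V C n (encode V C n M))
    (g := fun _ M => M) (fun n M => ?_) (fun n M => ?_) n M
  · rw [decode_eq, CtmTerm.node_encode, Node.map_map]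
  · rw [Node.map_id, BohmTree.toTree_node]

end Encoding

theorem mainTheorem8 (V : Type*) (C : Type*) :
    ∃ e : ∀ n : ℕ, BohmTree V C n ≃ CtmTerm V C n,
      (∀ (n : ℕ) (M : BohmTree V C (n + 1)),
        (e n (BohmTree.lam M)).val = encLam (e (n + 1) M).val) ∧
      (∀ (n : ℕ) (h : BHead V C n) (args : List (BohmTree V C n)),
        (e n (BohmTree.app h args)).val = encApp h (encSpine (args.map fun N => (e n N).val))) := by
  refine ⟨fun n => ⟨encode V C n, decode V C n, decode_encode, encode_decode⟩,
    fun n M => ?_, fun n h args => encode_toTree (.app h args)⟩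
  -- With `M` written as a node, `λ x. M` is the tree of `.lam ν`, and `encode_toTree` applies to
  -- both.
  obtain ⟨ν, rfl⟩ := Node.toTree_surjective M
  exact (encode_toTree (.lam ν)).trans (congrArg encLam (encode_toTree ν).symm)
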